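/- Let $c\ge 0$ and $\mathbb H_c=L^2(\mathbb R,e^{-2ct}\,dt)$ (complex-valued functions). Let $\partial_c$ be the operator $\partial_c f=f'$ on $\mathbb H_c$ with domain $D(\partial_c)=\{f\in\mathbb H_c : f \text{ locally absolutely continuous},\ f'\in\mathbb H_c\}$. It is normal and $\partial_c=c+iV_c$ with $V_c=(\partial_c-c)/i$ self-adjoint. For $0\le T_0<T$, a $(T_0,T)$-admissible cut-off function is a function $\varphi:\mathbb R\to\mathbb R$ for which there is a finite set $F\subset\mathbb R$ (empty if $T_0=0$) such that $\varphi$ is continuous on $\mathbb R\setminus F$, the closure of $\varphi(\mathbb R\setminus F)$ equals $\{\tau\in\mathbb R: T_0\le|\tau|\le T\}$, and, if $c=1$, $\varphi|_{\mathbb R\setminus F}$ extends to a holomorphic function on a neighbourhood of $\mathbb R\setminus F$ in $\mathbb C$. The corresponding $(T_0,T)$-truncated spectral operator is $\mathfrak a_c^{(T_0,T)}=\zeta\bigl(c+i\varphi(V_c)\bigr)$, where $\zeta$ is the Riemann zeta function and both functions of operators are taken in the measurable functional calculus for (possibly unbounded) normal operators. A possibly unbounded operator $A$ on $\mathbb H_c$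 with domain $D(A)$ is invertible if there is a bounded operator $B$, defined on all of $\mathbb H_c$ and with range $D(A)$, such that $ABu=u$ for all $u\in\mathbb H_c$ and $BAv=v$ for all $v\in D(A)$. The spectral operator $\mathfrak a_c=\zeta(\partial_c)$ is called almost invertible if there is $T_0\ge 0$ such that for every $T>T_0$ the truncated spectral operator $\mathfrak a_c^{(T_0,T)}$ is invertible. Then $\mathfrak a_c$ is almost invertible if and only if $\zeta$ has at most finitely many zeros on the line $\operatorname{Re}s=c$. This holds both when, in the definition of almost invertibility, invertibility is required for every $(T_0,T)$-admissible $\varphi$ and when it is required only for some $(T_0,T)$-admissible $\varphi$ for each $T>T_0$. -/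

import Mathlib

open MeasureTheory
open scoped ENNReal InnerProductSpace

noncomputable section

/-! ### The weighted Hilbert space and the infinitesimal shift -/

/-- The measure `μ_c(dt) = e^{-2ct} dt` on the real line. -/
def weightMeasure (c : ℝ) : Measure ℝ :=
  volume.withDensity fun t => ENNReal.ofReal (Real.exp (-2 * c * t))

/-- The Hilbert space `ℍ_c = L²(ℝ, e^{-2ct} dt)` of complex-valued functions. -/
abbrev WeightedL2 (c : ℝ) : Type := Lp ℂ 2 (weightMeasure c)

/-- (Locally) absolutely continuous functions on the real line. -/
def IsLocallyAC (g : ℝ → ℂ) : Prop :=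
  ∀ a b : ℝ, AbsolutelyContinuousOnInterval g a b

theorem IsLocallyAC.continuous {g : ℝ → ℂ} (hg : IsLocallyAC g) : Continuous g := by
  rw [continuous_iff_continuousAt]
  intro x
  have h := (hg (x - 1) (x + 1)).continuousOn
  rw [Set.uIcc_of_le (by linarith)] at h
  exact h.continuousAt (Icc_mem_nhds (by linarith) (by linarith))

theorem IsLocallyAC.ae_differentiableAt {g : ℝ → ℂ} (hg : IsLocallyAC g) :
    ∀ᵐ t : ℝ, DifferentiableAt ℝ g t := by
  have h : LocallyBoundedVariationOn g Set.univ := by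
    intro a b _ _
    rcases le_total a b with hab | hab
    · have := (hg a b).boundedVariationOn
      rw [Set.uIcc_of_le hab] at this
      exact this.mono Set.inter_subset_right
    · have := (hg b a).boundedVariationOn
      rw [Set.uIcc_of_le hab] at this
      refine this.mono ?_
      rintro x ⟨-, hx1, hx2⟩
      exact ⟨hab.trans hx1, hx2.trans hab⟩
  exact h.ae_differentiableAt

theorem weightMeasure_ae_iff (c : ℝ) {p : ℝ → Prop} :
    (∀ᵐ t ∂(weightMeasure c), p t) ↔ ∀ᵐ t : ℝ, p t := by
  have hm : Measurable fun t : ℝ => ENNReal.ofReal (Real.exp (-2 * c * t)) := by fun_prop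
  rw [weightMeasure, ae_withDensity_iff hm]
  have : ∀ t : ℝ, ENNReal.ofReal (Real.exp (-2 * c * t)) ≠ 0 := fun t => by
    simp [Real.exp_pos]
  simp only [ne_eq, this, not_false_eq_true, forall_const]

/-- The graph of `∂_c`: the pairs `(f, f')` with `f ∈ ℍ_c` (locally) absolutely continuous
and `f' ∈ ℍ_c`. -/
def shiftGraph (c : ℝ) : Submodule ℂ (WeightedL2 c × WeightedL2 c) where
  carrier := {p | ∃ g : ℝ → ℂ, IsLocallyAC g ∧
    (p.1 : ℝ → ℂ) =ᵐ[weightMeasure c] g ∧ (p.2 : ℝ → ℂ) =ᵐ[weightMeasure c] deriv g}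
  zero_mem' := by
    refine ⟨fun _ => 0, fun a b => ?_, Lp.coeFn_zero _ _ _, ?_⟩
    · exact (LipschitzWith.const (0 : ℂ)).lipschitzOnWith.absolutelyContinuousOnInterval
    · rw [deriv_const']
      exact Lp.coeFn_zero ℂ 2 (weightMeasure c)
  add_mem' := by
    rintro p q ⟨g, hg, hp1, hp2⟩ ⟨k, hk, hq1, hq2⟩
    refine ⟨g + k, fun a b => (hg a b).add (hk a b), ?_, ?_⟩
    · exact (Lp.coeFn_add _ _).trans (hp1.add hq1)
    · have hgd := (weightMeasure_ae_iff c).2 hg.ae_differentiableAt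
      have hkd := (weightMeasure_ae_iff c).2 hk.ae_differentiableAt
      filter_upwards [Lp.coeFn_add p.2 q.2, hp2, hq2, hgd, hkd] with t h1 h2 h3 h4 h5
      rw [deriv_add h4 h5, ← h2, ← h3]
      exact h1
  smul_mem' := by
    rintro a p ⟨g, hg, hp1, hp2⟩
    refine ⟨a • g, fun x y => (hg x y).const_smul a, ?_, ?_⟩
    · exact (Lp.coeFn_smul _ _).trans (hp1.const_smul a)
    · have hgd := (weightMeasure_ae_iff c).2 hg.ae_differentiableAt
      filter_upwards [Lp.coeFn_smul a p.2, hp2, hgd] with t h1 h2 h3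
      rw [deriv_const_smul a h3, ← h2]
      exact h1

theorem shiftGraph_single_valued (c : ℝ) :
    ∀ p ∈ shiftGraph c, p.1 = 0 → p.2 = 0 := by
  rintro p ⟨g, hg, h1, h2⟩ h0
  have hz : g =ᵐ[volume] fun _ => (0 : ℂ) := by
    refine (weightMeasure_ae_iff c).1 ?_
    rw [h0] at h1
    filter_upwards [h1, Lp.coeFn_zero ℂ 2 (weightMeasure c)] with t ht ht'
    rw [← ht, ht']
    rfl
  have hg0 : g = fun _ => 0 := (hg.continuous.ae_eq_iff_eq _ continuous_const).1 hz
  rw [Lp.eq_zero_iff_ae_eq_zero]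
  filter_upwards [h2] with t ht
  simp [ht, hg0]

/-- The infinitesimal shift `∂_c f = f'` with domain
`D(∂_c) = {f ∈ ℍ_c ∩ AC(ℝ) : f' ∈ ℍ_c}`. -/
def infinitesimalShift (c : ℝ) : WeightedL2 c →ₗ.[ℂ] WeightedL2 c :=
  (shiftGraph c).toLinearPMap

/-- The operator `V_c = (∂_c - c) / i`, with `D(V_c) = D(∂_c)`. -/
def momentumOperator (c : ℝ) : WeightedL2 c →ₗ.[ℂ] WeightedL2 c :=
  Complex.I⁻¹ • (((-(c : ℂ)) • LinearMap.id (R := ℂ) (M := WeightedL2 c)) +ᵥ infinitesimalShift c)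

/-! ### The measurable functional calculus of (unbounded) normal operators -/

section FunctionalCalculus

variable {H : Type*} [NormedAddCommGroup H] [InnerProductSpace ℂ H] [CompleteSpace H]

/-- A resolution of the identity (projection-valued Borel measure) on `ℂ` acting in `H`. Only the
values on Borel sets matter. -/
structure ResolutionOfIdentity (H : Type*) [NormedAddCommGroup H] [InnerProductSpace ℂ H]
    [CompleteSpace H] where
  proj : Set ℂ → H →L[ℂ] H
  isStarProjection : ∀ S, MeasurableSet S → IsStarProjection (proj S)
  empty : proj ∅ = 0
  univ : proj Set.univ = 1
  inter : ∀ S S', MeasurableSet S → MeasurableSet S' → proj (S ∩ S') = proj S * proj S'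
  iUnion : ∀ S : ℕ → Set ℂ, (∀ n, MeasurableSet (S n)) → Pairwise (Function.onFun Disjoint S) →
    ∀ x, HasSum (fun n => proj (S n) x) (proj (⋃ n, S n) x)

/-- The finite positive measure `S ↦ ⟨x, E(S) x⟩`. -/
def ResolutionOfIdentity.diagMeasure (E : ResolutionOfIdentity H) (x : H) : Measure ℂ :=
  Measure.ofMeasurable (fun S _ => ENNReal.ofReal (RCLike.re ⟪x, E.proj S x⟫_ℂ))
    (by simp [E.empty])
    (by
      intro S hS hd
      have hs : HasSum (fun n => RCLike.re ⟪x, E.proj (S n) x⟫_ℂ)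
          (RCLike.re ⟪x, E.proj (⋃ n, S n) x⟫_ℂ) :=
        (RCLike.reCLM (K := ℂ)).hasSum ((innerSL ℂ x).hasSum (E.iUnion S hS hd x))
      have hn : ∀ n, 0 ≤ RCLike.re ⟪x, E.proj (S n) x⟫_ℂ := fun n => by
        have hp := E.isStarProjection (S n) (hS n)
        have h1 : E.proj (S n) x = E.proj (S n) (E.proj (S n) x) := by
          conv_lhs => rw [← hp.isIdempotentElem.eq]
          rfl
        have hsym := (ContinuousLinearMap.isSelfAdjoint_iff_isSymmetric.1 hp.isSelfAdjoint)
        have h2 : ⟪x, E.proj (S n) x⟫_ℂ = ⟪E.proj (S n) x, E.proj (S n) x⟫_ℂ := by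
          rw [h1, ← h1]
          exact (hsym x (E.proj (S n) x)).symm ▸ congrArg _ h1
        rw [h2]
        exact inner_self_nonneg
      rw [← hs.tsum_eq, ENNReal.ofReal_tsum_of_nonneg hn hs.summable])

/-- `B = ∫ f dE`: the domain of `B` is `{x : ∫ |f|² d⟨x, E x⟩ < ∞}`, and
`⟨x, B x⟩ = ∫ f d⟨x, E x⟩` for `x` in the domain (which determines `B`, by polarization). -/
def ResolutionOfIdentity.IsIntegral (E : ResolutionOfIdentity H) (f : ℂ → ℂ)
    (B : H →ₗ.[ℂ] H) : Prop :=
  (∀ x : H, x ∈ B.domain ↔ ∫⁻ z, ‖f z‖ₑ ^ 2 ∂(E.diagMeasure x) < ∞) ∧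
    ∀ x : B.domain, ⟪(x : H), B x⟫_ℂ = ∫ z, f z ∂(E.diagMeasure (x : H))

/-- `B = f(A)` in the measurable functional calculus: `A = ∫ z dE(z)` and `B = ∫ f dE`. -/
def IsFunctionOf (f : ℂ → ℂ) (A B : H →ₗ.[ℂ] H) : Prop :=
  ∃ E : ResolutionOfIdentity H, E.IsIntegral (fun z => z) A ∧ E.IsIntegral f B

open Classical in
/-- The operator `f(A)`. By the spectral theorem it exists and is unique when `A` is normal and
`f` is Borel; where no such operator exists the value is the operator with domain `{0}`. -/
def functionalCalculus (f : ℂ → ℂ) (A : H →ₗ.[ℂ] H) : H →ₗ.[ℂ] H :=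
  if h : ∃ B, IsFunctionOf f A B then h.choose else ⊥

/-- Invertibility of a possibly unbounded operator `A`: there is a bounded everywhere defined `B`
with range `D(A)` such that `A B u = u` for all `u` and `B A v = v` for all `v ∈ D(A)`. -/
def IsInvertibleOperator (A : H →ₗ.[ℂ] H) : Prop :=
  ∃ B : H →L[ℂ] H, LinearMap.range (B : H →ₗ[ℂ] H) = A.domain ∧
    (∀ (u : H) (hu : B u ∈ A.domain), A ⟨B u, hu⟩ = u) ∧ ∀ v : A.domain, B (A v) = v

end FunctionalCalculus

/-! ### Truncated spectral operators -/

/-- `(T₀, T)`-admissible cut-off functions: continuous functions whose range has closure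
`{τ : T₀ ≤ |τ| ≤ T}`. When `T₀ > 0` this set is disconnected, and finitely many points at which
`φ` may jump are disregarded; when `T₀ = 0` there are none. When `c = 1`, the function `φ` is
moreover the restriction of a holomorphic function on a neighbourhood of the real line (less the
disregarded points). Being bounded, a meromorphic `φ` has no poles on the real line. -/
def IsAdmissibleCutoff (c T₀ T : ℝ) (φ : ℝ → ℝ) : Prop :=
  ∃ F : Set ℝ, F.Finite ∧ (T₀ = 0 → F = ∅) ∧ ContinuousOn φ Fᶜ ∧
    closure (φ '' Fᶜ) = {τ : ℝ | T₀ ≤ |τ| ∧ |τ| ≤ T} ∧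
    (c = 1 → ∃ (U : Set ℂ) (g : ℂ → ℂ), IsOpen U ∧ DifferentiableOn ℂ g U ∧
      ∀ x ∈ Fᶜ, (x : ℂ) ∈ U ∧ g x = φ x)

/-- The truncated infinitesimal shift `c + i φ(V_c)`. The spectrum of `V_c` is real, so that
`φ(V_c)` is formed with `z ↦ φ(Re z)`. -/
def truncatedShift (c : ℝ) (φ : ℝ → ℝ) : WeightedL2 c →ₗ.[ℂ] WeightedL2 c :=
  ((c : ℂ) • LinearMap.id (R := ℂ) (M := WeightedL2 c)) +ᵥ
    (Complex.I • functionalCalculus (fun z => (φ z.re : ℂ)) (momentumOperator c))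

/-- The truncated spectral operator `ζ(c + i φ(V_c))`. -/
def truncatedSpectralOperator (c : ℝ) (φ : ℝ → ℝ) : WeightedL2 c →ₗ.[ℂ] WeightedL2 c :=
  functionalCalculus riemannZeta (truncatedShift c φ)

/-- Almost invertibility of the spectral operator `ζ(∂_c)`, tested on all cut-off functions. -/
def AlmostInvertible (c : ℝ) : Prop :=
  ∃ T₀ : ℝ, 0 ≤ T₀ ∧ ∀ T : ℝ, T₀ < T → ∀ φ : ℝ → ℝ, IsAdmissibleCutoff c T₀ T φ →
    IsInvertibleOperator (truncatedSpectralOperator c φ)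

/-- Almost invertibility of the spectral operator `ζ(∂_c)`, tested on one cut-off function
for each `T`. -/
def AlmostInvertibleForSome (c : ℝ) : Prop :=
  ∃ T₀ : ℝ, 0 ≤ T₀ ∧ ∀ T : ℝ, T₀ < T → ∃ φ : ℝ → ℝ, IsAdmissibleCutoff c T₀ T φ ∧
    IsInvertibleOperator (truncatedSpectralOperator c φ)

end

/-!
Conjugating `∂_c` by `e^{-ct}` and the Fourier transform turns `V_c` into multiplication by `2πξ` on
`L²(ℝ)`, so that the spectrum of `V_c` is the real line and `V_c` has no eigenvalues; in particular
the finitely many jumps of a cut-off function `φ` are negligible for its spectral measure. An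
operator `∫ f dE` is invertible if and only if `0` is not in the `E`-essential range of `f`. This
essential range is the spectrum of `∫ f dE`, hence depends on the operator only and not on the
choice of `E` and `f`. The spectrum of `c + i φ(V_c)` is therefore the closure of the values of
`c + i φ`, that is `{c + iτ : T₀ ≤ |τ| ≤ T}`, and for `T₀ > 0` the operator `ζ(c + i φ(V_c))` is
invertible if and only if `ζ` has no zero on this compact set. Below any height, `ζ` has only
finitely many zeros, so that what remains is to choose `T₀` above the last zero on the line.
-/

open Filter Topology

/-! ### Integrals with respect to a resolution of the identity -/

theorem eq_of_forall_inner_self_eq {H : Type*} [NormedAddCommGroup H] [InnerProductSpace ℂ H]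
    {A B : H →ₗ[ℂ] H} (h : ∀ x, ⟪x, A x⟫_ℂ = ⟪x, B x⟫_ℂ) : A = B :=
  (ext_inner_map _ _).1 fun x => by rw [← inner_conj_symm, h, inner_conj_symm]

namespace ResolutionOfIdentity

section Basic

variable {H : Type*} [NormedAddCommGroup H] [InnerProductSpace ℂ H] [CompleteSpace H]
  (E : ResolutionOfIdentity H) {S T : Set ℂ}

theorem proj_proj (hS : MeasurableSet S) (hT : MeasurableSet T) (x : H) :
    E.proj S (E.proj T x) = E.proj (S ∩ T) x := by
  rw [E.inter S T hS hT, mul_apply_eq_comp]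

theorem inner_proj_right (hS : MeasurableSet S) (x y : H) :
    ⟪x, E.proj S y⟫_ℂ = ⟪E.proj S x, y⟫_ℂ :=
  (ContinuousLinearMap.isSelfAdjoint_iff_isSymmetric.1
    (E.isStarProjection S hS).isSelfAdjoint x y).symm

theorem inner_proj_self (hS : MeasurableSet S) (x : H) :
    ⟪x, E.proj S x⟫_ℂ = (‖E.proj S x‖ : ℂ) ^ 2 := by
  calc ⟪x, E.proj S x⟫_ℂ = ⟪x, E.proj S (E.proj S x)⟫_ℂ := by
        rw [E.proj_proj hS hS, Set.inter_self]
    _ = ⟪E.proj S x, E.proj S x⟫_ℂ := E.inner_proj_right hS x _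
    _ = (‖E.proj S x‖ : ℂ) ^ 2 := inner_self_eq_norm_sq_to_K _

theorem diagMeasure_apply (hS : MeasurableSet S) (x : H) :
    E.diagMeasure x S = ‖E.proj S x‖ₑ ^ 2 := by
  rw [diagMeasure, Measure.ofMeasurable_apply S hS, E.inner_proj_self hS, ← Complex.ofReal_pow,
    RCLike.re_to_complex, Complex.ofReal_re, ENNReal.ofReal_pow (norm_nonneg _), ofReal_norm]

theorem diagMeasure_univ (x : H) : E.diagMeasure x Set.univ = ‖x‖ₑ ^ 2 := by
  rw [E.diagMeasure_apply MeasurableSet.univ, E.univ, one_apply_eq_self]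

instance isFiniteMeasure_diagMeasure (x : H) : IsFiniteMeasure (E.diagMeasure x) :=
  ⟨by rw [E.diagMeasure_univ]; exact ENNReal.pow_lt_top enorm_lt_top⟩

theorem diagMeasure_real_apply (hS : MeasurableSet S) (x : H) :
    (E.diagMeasure x).real S = ‖E.proj S x‖ ^ 2 := by
  rw [Measure.real, E.diagMeasure_apply hS, ENNReal.toReal_pow, toReal_enorm]

theorem diagMeasure_proj (hS : MeasurableSet S) (x : H) :
    E.diagMeasure (E.proj S x) = (E.diagMeasure x).restrict S := by
  ext T hT
  rw [Measure.restrict_apply hT, E.diagMeasure_apply hT, E.diagMeasure_apply (hT.inter hS),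
    E.proj_proj hT hS]

theorem diagMeasure_zero : E.diagMeasure 0 = 0 :=
  Measure.measure_univ_eq_zero.1 (by rw [diagMeasure_univ, enorm_zero, zero_pow two_ne_zero])

theorem diagMeasure_smul (a : ℂ) (x : H) :
    E.diagMeasure (a • x) = (‖a‖ₑ ^ 2) • E.diagMeasure x := by
  ext S hS
  rw [Measure.smul_apply, E.diagMeasure_apply hS, E.diagMeasure_apply hS, map_smul, enorm_smul,
    mul_pow, smul_eq_mul]

theorem diagMeasure_add_le (x y : H) :
    E.diagMeasure (x + y) ≤ (2 : ℝ≥0∞) • (E.diagMeasure x + E.diagMeasure y) := by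
  refine Measure.le_iff.2 fun S hS => ?_
  rw [Measure.smul_apply, Measure.add_apply, smul_eq_mul, E.diagMeasure_apply hS,
    E.diagMeasure_apply hS, E.diagMeasure_apply hS, map_add]
  calc ‖E.proj S x + E.proj S y‖ₑ ^ 2
      ≤ (‖E.proj S x‖ₑ + ‖E.proj S y‖ₑ) ^ 2 := by gcongr; exact enorm_add_le _ _
    _ ≤ 2 * (‖E.proj S x‖ₑ ^ 2 + ‖E.proj S y‖ₑ ^ 2) := by
      simpa [ENNReal.rpow_ofNat, show (2 : ℝ) - 1 = 1 by norm_num] using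
        ENNReal.rpow_add_le_mul_rpow_add_rpow ‖E.proj S x‖ₑ ‖E.proj S y‖ₑ one_le_two

end Basic

section SimpleFunc

variable {H : Type*} [NormedAddCommGroup H] [InnerProductSpace ℂ H] [CompleteSpace H]
  (E : ResolutionOfIdentity H)

/-- The integral `∫ s dE` of a simple function, as a bounded operator. -/
noncomputable def simpleIntegral (s : SimpleFunc ℂ ℂ) : H →L[ℂ] H :=
  ∑ v ∈ s.range, v • E.proj (s ⁻¹' {v})

theorem inner_simpleIntegral (s : SimpleFunc ℂ ℂ) (x : H) :
    ⟪x, E.simpleIntegral s x⟫_ℂ = ∫ z, s z ∂(E.diagMeasure x) := by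
  rw [SimpleFunc.integral_eq_sum s (SimpleFunc.integrable_of_isFiniteMeasure s), simpleIntegral,
    sum_apply, inner_sum]
  refine Finset.sum_congr rfl fun v _ => ?_
  rw [smul_apply, inner_smul_right, E.inner_proj_self (s.measurableSet_fiber v),
    E.diagMeasure_real_apply (s.measurableSet_fiber v), Complex.real_smul, mul_comm,
    Complex.ofReal_pow]

theorem eq_simpleIntegral_of_inner {A : H →L[ℂ] H} {s : SimpleFunc ℂ ℂ}
    (h : ∀ x, ⟪x, A x⟫_ℂ = ∫ z, s z ∂(E.diagMeasure x)) : A = E.simpleIntegral s :=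
  ContinuousLinearMap.coe_injective <| eq_of_forall_inner_self_eq fun x =>
    (h x).trans (E.inner_simpleIntegral s x).symm

theorem simpleIntegral_sub (s t : SimpleFunc ℂ ℂ) :
    E.simpleIntegral (s - t) = E.simpleIntegral s - E.simpleIntegral t := by
  refine (E.eq_simpleIntegral_of_inner fun x => ?_).symm
  simp only [sub_apply, inner_sub_right, inner_simpleIntegral, SimpleFunc.coe_sub, Pi.sub_apply]
  exact (integral_sub (SimpleFunc.integrable_of_isFiniteMeasure s)
    (SimpleFunc.integrable_of_isFiniteMeasure t)).symm

theorem adjoint_simpleIntegral (s : SimpleFunc ℂ ℂ) :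
    (E.simpleIntegral s).adjoint = E.simpleIntegral (star s) := by
  refine E.eq_simpleIntegral_of_inner fun x => ?_
  rw [ContinuousLinearMap.adjoint_inner_right, ← inner_conj_symm, inner_simpleIntegral,
    ← integral_conj]
  rfl

theorem proj_simpleIntegral {S : Set ℂ} (hS : MeasurableSet S) (s : SimpleFunc ℂ ℂ) (x : H) :
    E.proj S (E.simpleIntegral s x) = E.simpleIntegral s (E.proj S x) := by
  simp only [simpleIntegral, sum_apply, smul_apply, map_sum, map_smul]
  refine Finset.sum_congr rfl fun v _ => ?_
  rw [E.proj_proj hS (s.measurableSet_fiber v), E.proj_proj (s.measurableSet_fiber v) hS,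
    Set.inter_comm]

theorem inner_simpleIntegral_proj {S : Set ℂ} (hS : MeasurableSet S) (s : SimpleFunc ℂ ℂ)
    (x : H) : ⟪x, E.simpleIntegral s (E.proj S x)⟫_ℂ = ∫ z in S, s z ∂(E.diagMeasure x) := by
  calc ⟪x, E.simpleIntegral s (E.proj S x)⟫_ℂ
      = ⟪x, E.proj S (E.simpleIntegral s (E.proj S x))⟫_ℂ := by
        rw [E.proj_simpleIntegral hS, E.proj_proj hS hS, Set.inter_self]
    _ = ⟪E.proj S x, E.simpleIntegral s (E.proj S x)⟫_ℂ := E.inner_proj_right hS x _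
    _ = ∫ z in S, s z ∂(E.diagMeasure x) := by rw [inner_simpleIntegral, E.diagMeasure_proj hS]

theorem simpleIntegral_mul (s t : SimpleFunc ℂ ℂ) :
    E.simpleIntegral (s * t) = E.simpleIntegral s * E.simpleIntegral t := by
  have expand (z : ℂ) : (s * t) z = ∑ v ∈ t.range, v * (t ⁻¹' {v}).indicator s z := by
    rw [Finset.sum_eq_single_of_mem (t z) (t.mem_range_self z) fun v _ hv => ?_]
    · rw [Set.indicator_of_mem (by simp), mul_comm, SimpleFunc.mul_apply]
    · rw [Set.indicator_of_notMem (by simpa using hv.symm), mul_zero]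
  refine (E.eq_simpleIntegral_of_inner fun x => ?_).symm
  have hs : Integrable s (E.diagMeasure x) := SimpleFunc.integrable_of_isFiniteMeasure s
  simp only [expand]
  rw [integral_finsetSum _ fun v _ => (hs.indicator (t.measurableSet_fiber v)).const_mul v,
    mul_apply_eq_comp, simpleIntegral.eq_def E t, sum_apply, map_sum, inner_sum]
  refine Finset.sum_congr rfl fun v _ => ?_
  rw [smul_apply, map_smul, inner_smul_right, E.inner_simpleIntegral_proj (t.measurableSet_fiber v),
    integral_const_mul, integral_indicator (t.measurableSet_fiber v)]

theorem enorm_simpleIntegral (s : SimpleFunc ℂ ℂ) (x : H) :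
    ‖E.simpleIntegral s x‖ₑ = eLpNorm s 2 (E.diagMeasure x) := by
  have hs : MemLp s 2 (E.diagMeasure x) := s.memLp_of_isFiniteMeasure 2 _
  rw [← Lp.enorm_toLp hs, ← ofReal_norm, ← ofReal_norm]
  congr 1
  rw [← sq_eq_sq₀ (norm_nonneg _) (norm_nonneg _), ← Complex.ofReal_inj, Complex.ofReal_pow,
    Complex.ofReal_pow]
  have inner_self (y : H) : (‖y‖ : ℂ) ^ 2 = ⟪y, y⟫_ℂ := (inner_self_eq_norm_sq_to_K y).symm
  calc (‖E.simpleIntegral s x‖ : ℂ) ^ 2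
      = ⟪x, (E.simpleIntegral s).adjoint (E.simpleIntegral s x)⟫_ℂ := by
        rw [ContinuousLinearMap.adjoint_inner_right, inner_self]
    _ = ∫ z, (star s * s) z ∂(E.diagMeasure x) := by
        rw [adjoint_simpleIntegral, ← mul_apply_eq_comp, ← simpleIntegral_mul,
          inner_simpleIntegral]
    _ = ⟪hs.toLp s, hs.toLp s⟫_ℂ := by
        rw [L2.inner_def]
        refine integral_congr_ae ?_
        filter_upwards [hs.coeFn_toLp] with z hz
        rw [hz, RCLike.inner_apply, mul_comm]
        rfl
    _ = (‖hs.toLp s‖ : ℂ) ^ 2 := inner_self_eq_norm_sq_to_K _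

end SimpleFunc

end ResolutionOfIdentity

theorem sq_eLpNorm_two {α F : Type*} {m : MeasurableSpace α} [NormedAddCommGroup F]
    (f : α → F) (μ : Measure α) : eLpNorm f 2 μ ^ 2 = ∫⁻ a, ‖f a‖ₑ ^ 2 ∂μ := by
  simpa using eLpNorm_nnreal_pow_eq_lintegral (f := f) (μ := μ) (p := 2) two_ne_zero

theorem lintegral_enorm_sq_lt_top_iff {α F : Type*} {m : MeasurableSpace α}
    [NormedAddCommGroup F] {f : α → F} {μ : Measure α} (hf : AEStronglyMeasurable f μ) :
    ∫⁻ a, ‖f a‖ₑ ^ 2 ∂μ < ∞ ↔ MemLp f 2 μ := by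
  rw [← sq_eLpNorm_two, ENNReal.pow_lt_top_iff]
  simp [MemLp, hf]

namespace ResolutionOfIdentity

section Integral

variable {H : Type*} [NormedAddCommGroup H] [InnerProductSpace ℂ H] [CompleteSpace H]
  (E : ResolutionOfIdentity H) {f g : ℂ → ℂ} {x : H}

/-- The domain of `∫ f dE`: the vectors `x` such that `f` is square integrable for `⟨x, E x⟩`. -/
def integralDomain (f : ℂ → ℂ) : Submodule ℂ H where
  carrier := {x | MemLp f 2 (E.diagMeasure x)}
  zero_mem' := by simp [E.diagMeasure_zero]
  add_mem' {x y} hx hy := by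
    have hadd : MemLp f 2 (E.diagMeasure x + E.diagMeasure y) := by
      refine ⟨hx.1.add_measure hy.1, ?_⟩
      have h := hx.2
      have h' := hy.2
      rw [eLpNorm_lt_top_iff_lintegral_rpow_enorm_lt_top two_ne_zero ENNReal.ofNat_ne_top] at *
      rw [lintegral_add_measure]
      exact ENNReal.add_lt_top.2 ⟨h, h'⟩
    exact (hadd.smul_measure ENNReal.ofNat_ne_top).mono_measure (E.diagMeasure_add_le x y)
  smul_mem' a x hx := by
    rw [Set.mem_ofPred_eq, E.diagMeasure_smul]
    exact MemLp.smul_measure hx (ENNReal.pow_ne_top enorm_ne_top)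

theorem mem_integralDomain : x ∈ E.integralDomain f ↔ MemLp f 2 (E.diagMeasure x) := Iff.rfl

theorem proj_mem_integralDomain (hx : x ∈ E.integralDomain f) {S : Set ℂ}
    (hS : MeasurableSet S) : E.proj S x ∈ E.integralDomain f := by
  rw [mem_integralDomain, E.diagMeasure_proj hS]
  exact MemLp.restrict S hx

/-- Simple functions converging to `f`, pointwise and in every `L²` space containing `f`. -/
noncomputable def approx (hf : Measurable f) (n : ℕ) : SimpleFunc ℂ ℂ :=
  SimpleFunc.approxOn f hf (Set.range f ∪ {0}) 0 (by simp) n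

theorem tendsto_approx (hf : Measurable f) (z : ℂ) :
    Tendsto (fun n => approx hf n z) atTop (𝓝 (f z)) :=
  SimpleFunc.tendsto_approxOn hf _ (subset_closure (by simp))

theorem norm_approx_le (hf : Measurable f) (n : ℕ) (z : ℂ) : ‖approx hf n z‖ ≤ 2 * ‖f z‖ := by
  rw [two_mul]
  exact SimpleFunc.norm_approxOn_zero_le hf (by simp) z n

theorem tendsto_integral_mul_approx {μ : Measure ℂ} (hf : Measurable f)
    (hg : AEStronglyMeasurable g μ) (hfg : Integrable (fun z => g z * f z) μ) :
    Tendsto (fun n => ∫ z, g z * approx hf n z ∂μ) atTop (𝓝 (∫ z, g z * f z ∂μ)) := by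
  refine tendsto_integral_of_dominated_convergence (fun z => 2 * ‖g z * f z‖)
    (fun n => hg.mul (approx hf n).aestronglyMeasurable) (hfg.norm.const_mul 2) (fun n => ?_)
    (Eventually.of_forall fun z => (tendsto_approx hf z).const_mul (g z))
  filter_upwards with z
  rw [norm_mul, norm_mul, mul_left_comm]
  exact mul_le_mul_of_nonneg_left (norm_approx_le hf n z) (norm_nonneg _)

theorem tendsto_toLp_approx {μ : Measure ℂ} [IsFiniteMeasure μ] (hf : Measurable f)
    (h : MemLp f 2 μ) :
    Tendsto (fun n => ((approx hf n).memLp_of_isFiniteMeasure 2 μ).toLp (approx hf n)) atTop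
      (𝓝 (h.toLp f)) :=
  SimpleFunc.tendsto_approxOn_range_Lp ENNReal.ofNat_ne_top hf h

theorem cauchySeq_simpleIntegral_approx (hf : Measurable f) (hx : x ∈ E.integralDomain f) :
    CauchySeq fun n => E.simpleIntegral (approx hf n) x := by
  have hLp := (tendsto_toLp_approx hf hx).cauchySeq
  rw [EMetric.cauchySeq_iff] at hLp ⊢
  refine fun ε hε => (hLp ε hε).imp fun N hN m hm n hn => ?_
  rw [edist_eq_enorm_sub, ← sub_apply, ← simpleIntegral_sub, enorm_simpleIntegral,
    SimpleFunc.coe_sub, ← Lp.edist_toLp_toLp]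
  exact hN m hm n hn

theorem tendsto_simpleIntegral_approx (hf : Measurable f) (hx : x ∈ E.integralDomain f) :
    Tendsto (fun n => E.simpleIntegral (approx hf n) x) atTop
      (𝓝 (limUnder atTop fun n => E.simpleIntegral (approx hf n) x)) :=
  (E.cauchySeq_simpleIntegral_approx hf hx).tendsto_limUnder

/-- The operator `∫ f dE`, defined as a strong limit of integrals of simple functions. -/
noncomputable def integral (hf : Measurable f) : H →ₗ.[ℂ] H where
  domain := E.integralDomain f
  toFun := linearMapOfTendsto _
    (fun n => (E.simpleIntegral (approx hf n)).toLinearMap ∘ₗ (E.integralDomain f).subtype)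
    (tendsto_pi_nhds.2 fun x => E.tendsto_simpleIntegral_approx hf x.2)

variable {E} in
theorem tendsto_integral (hf : Measurable f) (x : (E.integral hf).domain) :
    Tendsto (fun n => E.simpleIntegral (approx hf n) x) atTop (𝓝 (E.integral hf x)) :=
  E.tendsto_simpleIntegral_approx hf x.2

theorem inner_integral (hf : Measurable f) (x : (E.integral hf).domain) :
    ⟪(x : H), E.integral hf x⟫_ℂ = ∫ z, f z ∂(E.diagMeasure x) := by
  have hint : Integrable f (E.diagMeasure x) := MemLp.integrable one_le_two x.2
  refine tendsto_nhds_unique (tendsto_const_nhds.inner (tendsto_integral hf x)) ?_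
  simpa only [inner_simpleIntegral, one_mul] using
    tendsto_integral_mul_approx (g := fun _ => 1) hf aestronglyMeasurable_const
      (by simpa only [one_mul] using hint)

theorem enorm_integral (hf : Measurable f) (x : (E.integral hf).domain) :
    ‖E.integral hf x‖ₑ = eLpNorm f 2 (E.diagMeasure x) := by
  have hf₂ : MemLp f 2 (E.diagMeasure x) := x.2
  refine tendsto_nhds_unique (tendsto_integral hf x).enorm ?_
  simpa only [enorm_simpleIntegral, Lp.enorm_toLp] using (tendsto_toLp_approx hf hf₂).enorm

theorem proj_integral (hf : Measurable f) (x : (E.integral hf).domain) {S : Set ℂ}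
    (hS : MeasurableSet S) :
    E.proj S (E.integral hf x) = E.integral hf ⟨E.proj S x, E.proj_mem_integralDomain x.2 hS⟩ := by
  refine tendsto_nhds_unique (((E.proj S).continuous.tendsto _).comp (tendsto_integral hf x)) ?_
  simpa only [Function.comp_def, E.proj_simpleIntegral hS] using
    tendsto_integral hf ⟨E.proj S x, E.proj_mem_integralDomain x.2 hS⟩

theorem diagMeasure_integral (hf : Measurable f) (x : (E.integral hf).domain) :
    E.diagMeasure (E.integral hf x) = (E.diagMeasure x).withDensity fun z => ‖f z‖ₑ ^ 2 := by
  ext S hS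
  rw [withDensity_apply _ hS, E.diagMeasure_apply hS, E.proj_integral hf x hS, enorm_integral,
    E.diagMeasure_proj hS, sq_eLpNorm_two]

theorem isIntegral_integral (hf : Measurable f) : E.IsIntegral f (E.integral hf) := by
  exact ⟨fun x => (lintegral_enorm_sq_lt_top_iff hf.aestronglyMeasurable).symm,
    E.inner_integral hf⟩

end Integral
end ResolutionOfIdentity

theorem inner_eq_zero_of_forall_inner_self_eq_zero {H : Type*} [NormedAddCommGroup H]
    [InnerProductSpace ℂ H] {D : Submodule ℂ H} {A : D →ₗ[ℂ] H}
    (hA : ∀ x : D, ⟪(x : H), A x⟫_ℂ = 0) (x y : D) : ⟪(y : H), A x⟫_ℂ = 0 := by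
  have hadd : ⟪(y : H), A x⟫_ℂ + ⟪(x : H), A y⟫_ℂ = 0 := by
    simpa [inner_add_left, inner_add_right, hA] using hA (x + y)
  have hsub : ⟪(x : H), A y⟫_ℂ - ⟪(y : H), A x⟫_ℂ = 0 := by
    have h := hA (x + Complex.I • y)
    simp only [map_add, map_smul, Submodule.coe_add, Submodule.coe_smul, inner_add_left,
      inner_add_right, inner_smul_left, inner_smul_right, hA, Complex.conj_I] at h
    refine (mul_eq_zero.1 ?_).resolve_left Complex.I_ne_zero
    linear_combination h
  linear_combination (hadd - hsub) / 2

namespace ResolutionOfIdentity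

section Uniqueness

variable {H : Type*} [NormedAddCommGroup H] [InnerProductSpace ℂ H] [CompleteSpace H]
  {E : ResolutionOfIdentity H} {f : ℂ → ℂ} {B : H →ₗ.[ℂ] H}

theorem diagMeasure_eq_zero_iff {x : H} : E.diagMeasure x = 0 ↔ x = 0 := by
  rw [← Measure.measure_univ_eq_zero, diagMeasure_univ, sq_eq_zero_iff, enorm_eq_zero]

theorem proj_mem_integralDomain_of_bound (hf : Measurable f) {S : Set ℂ} (hS : MeasurableSet S)
    {C : ℝ} (hC : ∀ z ∈ S, ‖f z‖ ≤ C) (x : H) : E.proj S x ∈ E.integralDomain f := by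
  rw [mem_integralDomain, E.diagMeasure_proj hS]
  exact .of_bound hf.aestronglyMeasurable C ((ae_restrict_iff' hS).2 (Eventually.of_forall hC))

theorem eq_zero_of_forall_mem_integralDomain (hf : Measurable f) {w : H}
    (hw : ∀ y ∈ E.integralDomain f, ⟪y, w⟫_ℂ = 0) : w = 0 := by
  let S (n : ℕ) : Set ℂ := {z | ‖f z‖ ≤ n}
  have hS (n : ℕ) : MeasurableSet (S n) := measurableSet_le hf.norm measurable_const
  have null (n : ℕ) : E.diagMeasure w (S n) = 0 := by
    have h := hw _ (proj_mem_integralDomain_of_bound hf (hS n) (fun z hz => hz) w)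
    rw [← E.inner_proj_right (hS n), E.inner_proj_self (hS n), sq_eq_zero_iff,
      Complex.ofReal_eq_zero, norm_eq_zero] at h
    simp [E.diagMeasure_apply (hS n), h]
  have cover : ⋃ n, S n = Set.univ :=
    Set.eq_univ_of_forall fun z => Set.mem_iUnion.2 (exists_nat_ge ‖f z‖)
  rw [← E.diagMeasure_eq_zero_iff, ← Measure.measure_univ_eq_zero, ← cover]
  exact measure_iUnion_null null

theorem IsIntegral.mem_domain_iff (hf : Measurable f) (hB : E.IsIntegral f B) {x : H} :
    x ∈ B.domain ↔ x ∈ E.integralDomain f := by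
  rw [hB.1 x, lintegral_enorm_sq_lt_top_iff hf.aestronglyMeasurable, mem_integralDomain]

theorem IsIntegral.eq_integral (hf : Measurable f) (hB : E.IsIntegral f B) :
    B = E.integral hf := by
  obtain ⟨D, B⟩ := B
  obtain rfl : D = E.integralDomain f := Submodule.ext fun x => hB.mem_domain_iff hf
  let I : E.integralDomain f →ₗ[ℂ] H := (E.integral hf).toFun
  have form_eq (x : E.integralDomain f) : ⟪(x : H), (B - I) x⟫_ℂ = 0 := by
    rw [LinearMap.sub_apply, inner_sub_right, sub_eq_zero]
    exact (hB.2 x).trans (E.inner_integral hf x).symm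
  have apply_eq (x : E.integralDomain f) : B x = I x :=
    sub_eq_zero.1 (eq_zero_of_forall_mem_integralDomain hf fun y hy =>
      inner_eq_zero_of_forall_inner_self_eq_zero form_eq x ⟨y, hy⟩)
  exact congrArg _ (LinearMap.ext apply_eq)

theorem IsIntegral.enorm_apply (hf : Measurable f) (hB : E.IsIntegral f B) (x : B.domain) :
    ‖B x‖ₑ = eLpNorm f 2 (E.diagMeasure x) := by
  obtain rfl := hB.eq_integral hf
  exact E.enorm_integral hf x

theorem IsIntegral.affine (hf : Measurable f) (hB : E.IsIntegral f B) (a : ℂ) {b : ℂ}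
    (hb : b ≠ 0) :
    E.IsIntegral (fun z => a + b * f z) ((a • LinearMap.id (R := ℂ) (M := H)) +ᵥ (b • B)) := by
  have memLp_iff (x : H) : MemLp (fun z => a + b * f z) 2 (E.diagMeasure x) ↔
      MemLp f 2 (E.diagMeasure x) := by
    refine ⟨fun h => ?_, fun h => (memLp_const a).add (h.const_mul b)⟩
    simpa [hb] using (h.sub (memLp_const a)).const_mul b⁻¹
  refine ⟨fun x => ?_, fun x => ?_⟩
  · rw [lintegral_enorm_sq_lt_top_iff (by fun_prop), memLp_iff, ← mem_integralDomain,
      ← hB.mem_domain_iff hf]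
    rfl
  · have hx : x.1 ∈ B.domain := x.2
    have hint : Integrable f (E.diagMeasure x) :=
      MemLp.integrable one_le_two ((hB.mem_domain_iff hf).1 hx)
    rw [integral_add (integrable_const a) (hint.const_mul b), integral_const_mul,
      ← hB.2 ⟨x, hx⟩, integral_const, diagMeasure_real_apply _ .univ, E.univ]
    change ⟪x.1, a • x.1 + b • B ⟨x, hx⟩⟫_ℂ = _
    rw [inner_add_right, inner_smul_right, inner_smul_right, inner_self_eq_norm_sq_to_K,
      one_apply_eq_self]
    simp only [LinearPMap.vadd_domain, LinearPMap.smul_domain, Complex.coe_algebraMap,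
      Subtype.coe_eta, Complex.real_smul, Complex.ofReal_pow, add_left_inj]
    ring

end Uniqueness

section EssRange

variable {H : Type*} [NormedAddCommGroup H] [InnerProductSpace ℂ H] [CompleteSpace H]
  (E : ResolutionOfIdentity H) {f : ℂ → ℂ}

/-- The filter of sets of full `E`-measure. -/
noncomputable def ae : Filter ℂ := ⨆ x, MeasureTheory.ae (E.diagMeasure x)

theorem eventually_ae_iff {p : ℂ → Prop} :
    (∀ᶠ z in E.ae, p z) ↔ ∀ x, ∀ᵐ z ∂(E.diagMeasure x), p z := eventually_iSup

instance countableInterFilter_ae : CountableInterFilter E.ae where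
  countable_sInter_mem _ hS h := mem_iSup.2 fun x =>
    (countable_sInter_mem hS).2 fun s hs => mem_iSup.1 (h s hs) x

theorem eventually_notMem_ae_iff {S : Set ℂ} (hS : MeasurableSet S) :
    (∀ᶠ z in E.ae, z ∉ S) ↔ ∀ x, E.proj S x = 0 := by
  simp [eventually_ae_iff, ← measure_eq_zero_iff_ae_notMem, E.diagMeasure_apply hS]

/-- The essential range of `f` with respect to `E`. -/
def essRange (f : ℂ → ℂ) : Set ℂ := {a | MapClusterPt a E.ae f}

variable {E}

theorem notMem_essRange {a : ℂ} :
    a ∉ E.essRange f ↔ ∃ δ > 0, ∀ᶠ z in E.ae, δ ≤ ‖f z - a‖ₑ := by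
  simp [essRange, Metric.nhds_basis_eball.mapClusterPt_iff_frequently, edist_eq_enorm_sub]

theorem isClosed_essRange : IsClosed (E.essRange f) := isClosed_setOfPred_clusterPt

theorem eventually_mem_essRange (f : ℂ → ℂ) : ∀ᶠ z in E.ae, f z ∈ E.essRange f := by
  by_contra h
  rw [not_eventually] at h
  have : (map f E.ae ⊓ 𝓟 (E.essRange f)ᶜ).NeBot := frequently_iff_neBot.1 (frequently_map.2 h)
  obtain ⟨a, ha, hfa⟩ := (HereditarilyLindelofSpace.isLindelof (E.essRange f)ᶜ)
    (f := map f E.ae ⊓ 𝓟 (E.essRange f)ᶜ) inf_le_right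
  exact ha (hfa.mono inf_le_left)

theorem essRange_subset {S : Set ℂ} (hS : IsClosed S) (h : ∀ᶠ z in E.ae, f z ∈ S) :
    E.essRange f ⊆ S := fun _ ha =>
  hS.mem_of_mapClusterPt ha h

theorem apply_mem_essRange {a : ℂ} (ha : a ∈ E.essRange fun z => z) (hf : ContinuousAt f a) :
    f a ∈ E.essRange f :=
  MapClusterPt.continuousAt_comp hf ha

end EssRange
section Invertibility

variable {H : Type*} [NormedAddCommGroup H] [InnerProductSpace ℂ H] [CompleteSpace H]
  {E : ResolutionOfIdentity H} {f g : ℂ → ℂ} {B : H →ₗ.[ℂ] H}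

theorem integral_mem_integralDomain_iff (hf : Measurable f) (hg : Measurable g)
    (y : (E.integral hg).domain) :
    E.integral hg y ∈ E.integralDomain f ↔ MemLp (fun z => g z * f z) 2 (E.diagMeasure y) := by
  rw [mem_integralDomain, ← lintegral_enorm_sq_lt_top_iff hf.aestronglyMeasurable,
    ← lintegral_enorm_sq_lt_top_iff (by fun_prop), E.diagMeasure_integral,
    lintegral_withDensity_eq_lintegral_mul _ (hg.enorm.pow_const 2) (hf.enorm.pow_const 2)]
  simp only [Pi.mul_apply, enorm_mul, mul_pow]

theorem inner_simpleIntegral_integral (hg : Measurable g) (s : SimpleFunc ℂ ℂ)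
    (y : (E.integral hg).domain) :
    ⟪(y : H), E.simpleIntegral s (E.integral hg y)⟫_ℂ =
      ∫ z, s z * g z ∂(E.diagMeasure y) := by
  have hgL2 : MemLp g 2 (E.diagMeasure y) := y.2
  have hsg : Integrable (fun z => s z * g z) (E.diagMeasure y) :=
    (s.memLp_of_isFiniteMeasure 2 _).integrable_mul hgL2
  refine tendsto_nhds_unique (tendsto_const_nhds.inner
    (((E.simpleIntegral s).continuous.tendsto _).comp (tendsto_integral hg y))) ?_
  simpa only [Function.comp_def, ← mul_apply_eq_comp, ← simpleIntegral_mul, inner_simpleIntegral,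
    SimpleFunc.mul_apply] using tendsto_integral_mul_approx hg s.aestronglyMeasurable hsg

theorem inner_integral_integral (hf : Measurable f) (hg : Measurable g)
    (y : (E.integral hg).domain) (hy : E.integral hg y ∈ E.integralDomain f) :
    ⟪(y : H), E.integral hf ⟨E.integral hg y, hy⟩⟫_ℂ =
      ∫ z, g z * f z ∂(E.diagMeasure y) := by
  have hgf : Integrable (fun z => g z * f z) (E.diagMeasure y) :=
    ((integral_mem_integralDomain_iff hf hg y).1 hy).integrable one_le_two
  refine tendsto_nhds_unique (tendsto_const_nhds.inner (tendsto_integral hf ⟨_, hy⟩)) ?_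
  simpa only [inner_simpleIntegral_integral, mul_comm] using
    tendsto_integral_mul_approx hf hg.aestronglyMeasurable hgf

theorem exists_continuousLinearMap_eq_integral (hg : Measurable g) {C : ℝ≥0∞} (hC : C ≠ ∞)
    (h : ∀ᶠ z in E.ae, ‖g z‖ₑ ≤ C) :
    ∃ (hD : ∀ x, x ∈ E.integralDomain g) (G : H →L[ℂ] H),
      ∀ x, G x = E.integral hg ⟨x, hD x⟩ := by
  lift C to NNReal using hC
  have bound (x : H) : ∀ᵐ z ∂(E.diagMeasure x), ‖g z‖ₑ ≤ C := E.eventually_ae_iff.1 h x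
  have hD (x : H) : x ∈ E.integralDomain g :=
    .of_enorm_bound hg.aestronglyMeasurable ENNReal.coe_ne_top (bound x)
  let G : H →ₗ[ℂ] H := (E.integral hg).toFun ∘ₗ LinearMap.id.codRestrict (E.integralDomain g) hD
  refine ⟨hD, G.mkContinuous C fun x => ?_, fun _ => rfl⟩
  have henorm : ‖G x‖ₑ ≤ C * ‖x‖ₑ := calc
    ‖G x‖ₑ = eLpNorm g 2 (E.diagMeasure x) := E.enorm_integral hg _
    _ ≤ C * (‖x‖ₑ ^ 2) ^ (2 : ℝ)⁻¹ := by
      simpa [diagMeasure_univ] using eLpNorm_le_of_ae_enorm_bound (p := 2) (bound x)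
    _ = C * ‖x‖ₑ := by rw [← ENNReal.rpow_natCast, ← ENNReal.rpow_mul]; simp
  simpa only [enorm_eq_nnnorm, ← ENNReal.coe_mul, ENNReal.coe_le_coe, ← NNReal.coe_le_coe,
    NNReal.coe_mul, coe_nnnorm] using henorm

theorem IsIntegral.ker_eq_bot_iff (hf : Measurable f) (hB : E.IsIntegral f B) :
    LinearMap.ker B.toFun = ⊥ ↔ ∀ᶠ z in E.ae, f z ≠ 0 := by
  rw [LinearMap.ker_eq_bot']
  have apply_eq_zero_iff (x : B.domain) : B.toFun x = 0 ↔ ∀ᵐ z ∂(E.diagMeasure x), f z = 0 := by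
    rw [LinearPMap.toFun_eq_coe, ← enorm_eq_zero, hB.enorm_apply hf,
      eLpNorm_eq_zero_iff hf.aestronglyMeasurable two_ne_zero]
    rfl
  constructor
  · intro hinj
    have hS : MeasurableSet (f ⁻¹' {0}) := hf (measurableSet_singleton 0)
    refine (E.eventually_notMem_ae_iff hS).2 fun x => ?_
    have hx : E.proj (f ⁻¹' {0}) x ∈ B.domain := (hB.mem_domain_iff hf).2 <|
      proj_mem_integralDomain_of_bound hf hS (C := 0) (fun z hz => by simp_all) x
    refine congrArg Subtype.val (hinj ⟨_, hx⟩ ((apply_eq_zero_iff _).2 ?_))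
    rw [E.diagMeasure_proj hS]
    exact ae_restrict_mem hS
  · intro h x hx
    refine Subtype.ext (diagMeasure_eq_zero_iff (E := E).1 (ae_eq_bot.1 ?_))
    rw [← eventually_false_iff_eq_bot]
    filter_upwards [(apply_eq_zero_iff x).1 hx, E.eventually_ae_iff.1 h x] with z h₀ h₁
      using h₁ h₀

theorem IsIntegral.eventually_le_enorm (hf : Measurable f) (hB : E.IsIntegral f B) {δ : NNReal}
    (hδ : ∀ x : B.domain, δ * ‖(x : H)‖ₑ ≤ ‖B x‖ₑ) : ∀ᶠ z in E.ae, δ ≤ ‖f z‖ₑ := by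
  let S : Set ℂ := {z | ‖f z‖ₑ < δ}
  have hS : MeasurableSet S := measurableSet_lt hf.enorm measurable_const
  suffices ∀ x, E.proj S x = 0 by
    simpa [S] using (E.eventually_notMem_ae_iff hS).2 this
  intro x
  have hy : E.proj S x ∈ E.integralDomain f :=
    proj_mem_integralDomain_of_bound hf hS (C := δ) (fun z (hz : ‖f z‖ₑ < δ) => by
      exact_mod_cast hz.le) x
  by_contra hne
  refine (hδ ⟨_, (hB.mem_domain_iff hf).2 hy⟩).not_gt ?_
  rw [hB.enorm_apply hf, ← ENNReal.pow_lt_pow_left_iff two_ne_zero, sq_eLpNorm_two, mul_pow,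
    ← diagMeasure_univ, ← lintegral_const]
  refine lintegral_strict_mono (diagMeasure_eq_zero_iff.not.2 hne) aemeasurable_const
    ((lintegral_enorm_sq_lt_top_iff hf.aestronglyMeasurable).2 hy).ne ?_
  rw [E.diagMeasure_proj hS]
  filter_upwards [ae_restrict_mem hS] with z hz
  gcongr
  exact hz

theorem isInvertibleOperator_integral (hf : Measurable f) {δ : ℝ≥0∞} (hδ : 0 < δ)
    (hfδ : ∀ᶠ z in E.ae, δ ≤ ‖f z‖ₑ) : IsInvertibleOperator (E.integral hf) := by
  have hf₀ : ∀ᶠ z in E.ae, f z ≠ 0 := hfδ.mono fun z hz => enorm_ne_zero.1 (hδ.trans_le hz).ne'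
  have hinv : Measurable f⁻¹ := hf.inv
  obtain ⟨hD, G, hG⟩ := E.exists_continuousLinearMap_eq_integral hinv
    (ENNReal.inv_ne_top.2 hδ.ne') <| (hf₀.and hfδ).mono fun z hz => by
      rw [Pi.inv_apply, enorm_inv hz.1]
      exact ENNReal.inv_le_inv.2 hz.2
  have mul_eq_one (x : H) : ∀ᵐ z ∂(E.diagMeasure x), f⁻¹ z * f z = 1 :=
    (E.eventually_ae_iff.1 hf₀ x).mono fun z hz => inv_mul_cancel₀ hz
  have hGD (u : H) : G u ∈ E.integralDomain f := by
    rw [hG, integral_mem_integralDomain_iff hf]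
    exact (memLp_const 1).ae_eq ((mul_eq_one u).mono fun _ => Eq.symm)
  have right_inv : (E.integral hf).toFun ∘ₗ G.toLinearMap.codRestrict _ hGD = LinearMap.id := by
    refine eq_of_forall_inner_self_eq fun u => ?_
    have hu : E.integral hinv ⟨u, hD u⟩ ∈ E.integralDomain f := hG u ▸ hGD u
    calc ⟪u, E.integral hf ⟨G u, hGD u⟩⟫_ℂ
        = ⟪u, E.integral hf ⟨E.integral hinv ⟨u, hD u⟩, hu⟩⟫_ℂ := by simp only [hG]
      _ = ∫ z, f⁻¹ z * f z ∂(E.diagMeasure u) := inner_integral_integral hf hinv ⟨u, hD u⟩ hu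
      _ = ⟪u, u⟫_ℂ := by
        rw [integral_congr_ae (mul_eq_one u), integral_const, diagMeasure_real_apply _ .univ,
          E.univ, one_apply_eq_self, inner_self_eq_norm_sq_to_K]
        simp
  have apply_G (u : H) : E.integral hf ⟨G u, hGD u⟩ = u := LinearMap.congr_fun right_inv u
  have left_inv (v : (E.integral hf).domain) : G (E.integral hf v) = v := by
    refine congrArg Subtype.val (sub_eq_zero.1 <|
      LinearMap.ker_eq_bot'.1 (((E.isIntegral_integral hf).ker_eq_bot_iff hf).2 hf₀)
        (⟨_, hGD (E.integral hf v)⟩ - v) ?_)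
    rw [LinearPMap.toFun_eq_coe, LinearPMap.map_sub, apply_G, sub_self]
  refine ⟨G, le_antisymm ?_ fun v hv => ⟨_, left_inv ⟨v, hv⟩⟩, fun u _ => apply_G u, left_inv⟩
  rintro _ ⟨u, rfl⟩
  exact hGD u

theorem IsIntegral.isInvertibleOperator_iff (hf : Measurable f) (hB : E.IsIntegral f B) :
    IsInvertibleOperator B ↔ 0 ∉ E.essRange f := by
  simp only [notMem_essRange, sub_zero]
  constructor
  · rintro ⟨G, -, -, left_inv⟩
    refine ⟨((‖G‖₊ + 1)⁻¹ : NNReal), by simp, hB.eventually_le_enorm hf fun x => ?_⟩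
    rw [ENNReal.coe_inv (by positivity), ← ENNReal.div_eq_inv_mul]
    refine ENNReal.div_le_of_le_mul' ?_
    calc ‖(x : H)‖ₑ ≤ ‖G‖ₑ * ‖B x‖ₑ := by simpa only [left_inv] using G.le_opENorm (B x)
      _ ≤ (‖G‖₊ + 1 : NNReal) * ‖B x‖ₑ := by gcongr; simp [enorm_eq_nnnorm]
  · rintro ⟨δ, hδ, hfδ⟩
    exact hB.eq_integral hf ▸ isInvertibleOperator_integral hf hδ hfδ

end Invertibility
section Comparison

variable {H : Type*} [NormedAddCommGroup H] [InnerProductSpace ℂ H] [CompleteSpace H]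
  {E E' : ResolutionOfIdentity H} {f f' : ℂ → ℂ} {A : H →ₗ.[ℂ] H}

theorem IsIntegral.mem_essRange_iff (hf : Measurable f) (hA : E.IsIntegral f A) {a : ℂ} :
    a ∈ E.essRange f ↔
      ¬IsInvertibleOperator ((-a • LinearMap.id (R := ℂ) (M := H)) +ᵥ ((1 : ℂ) • A)) := by
  rw [(hA.affine hf (-a) one_ne_zero).isInvertibleOperator_iff (by fun_prop), not_not,
    ← not_iff_not, notMem_essRange, notMem_essRange]
  simp only [sub_zero, one_mul, neg_add_eq_sub]

theorem IsIntegral.essRange_eq (hf : Measurable f) (hf' : Measurable f')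
    (hE : E.IsIntegral f A) (hE' : E'.IsIntegral f' A) : E.essRange f = E'.essRange f' :=
  Set.ext fun _ => (hE.mem_essRange_iff hf).trans (hE'.mem_essRange_iff hf').symm

theorem IsIntegral.eventually_ne_iff (hf : Measurable f) (hf' : Measurable f')
    (hE : E.IsIntegral f A) (hE' : E'.IsIntegral f' A) (a : ℂ) :
    (∀ᶠ z in E.ae, f z ≠ a) ↔ ∀ᶠ z in E'.ae, f' z ≠ a := by
  have h := ((hE.affine hf (-a) one_ne_zero).ker_eq_bot_iff (by fun_prop)).symm.trans
    ((hE'.affine hf' (-a) one_ne_zero).ker_eq_bot_iff (by fun_prop))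
  simpa only [one_mul, neg_add_eq_sub, sub_ne_zero] using h

end Comparison

section Map

variable {H : Type*} [NormedAddCommGroup H] [InnerProductSpace ℂ H] [CompleteSpace H]
  (E : ResolutionOfIdentity H) {f h : ℂ → ℂ} {A : H →ₗ.[ℂ] H}

/-- The image of a resolution of the identity under a Borel map. -/
def map (hh : Measurable h) : ResolutionOfIdentity H where
  proj S := E.proj (h ⁻¹' S)
  isStarProjection S hS := E.isStarProjection _ (hh hS)
  empty := by rw [Set.preimage_empty, E.empty]
  univ := by rw [Set.preimage_univ, E.univ]
  inter S S' hS hS' := by rw [Set.preimage_inter, E.inter _ _ (hh hS) (hh hS')]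
  iUnion S hS hd x := by
    rw [Set.preimage_iUnion]
    exact E.iUnion _ (fun n => hh (hS n)) (fun m n hmn => (hd hmn).preimage h) x

theorem diagMeasure_map (hh : Measurable h) (x : H) :
    (E.map hh).diagMeasure x = (E.diagMeasure x).map h := by
  ext S hS
  rw [Measure.map_apply hh hS, diagMeasure_apply _ hS, diagMeasure_apply _ (hh hS)]
  rfl

variable {E}

theorem IsIntegral.map (hf : Measurable f) (hh : Measurable h)
    (hA : E.IsIntegral (fun z => f (h z)) A) : (E.map hh).IsIntegral f A := by
  refine ⟨fun x => ?_, fun x => ?_⟩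
  · rw [hA.1, diagMeasure_map, lintegral_map (hf.enorm.pow_const 2) hh]
  · rw [hA.2, diagMeasure_map, integral_map hh.aemeasurable hf.aestronglyMeasurable]

theorem IsIntegral.isFunctionOf_functionalCalculus (hh : Measurable h) (hA : E.IsIntegral h A)
    (hf : Measurable f) : IsFunctionOf f A (functionalCalculus f A) := by
  have exists_isFunctionOf : ∃ B, IsFunctionOf f A B :=
    ⟨_, E.map hh, hA.map measurable_id' hh, isIntegral_integral _ hf⟩
  rw [functionalCalculus, dif_pos exists_isFunctionOf]
  exact exists_isFunctionOf.choose_spec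

end Map
end ResolutionOfIdentity

/-! ### Multiplication operators -/

section IndicatorMul

variable {α : Type*} [MeasurableSpace α] {ν : Measure α} {S T : Set α}

/-- Multiplication by the indicator function of a measurable set on `L²`. -/
noncomputable def indicatorMul (ν : Measure α) (hS : MeasurableSet S) :
    Lp ℂ 2 ν →L[ℂ] Lp ℂ 2 ν :=
  (ContinuousLinearMap.mul ℂ ℂ).holderL ν ∞ 2 2 ((memLp_top_const (1 : ℂ)).indicator hS).toLp

theorem coeFn_indicatorMul (hS : MeasurableSet S) (u : Lp ℂ 2 ν) :
    indicatorMul ν hS u =ᵐ[ν] S.indicator u := by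
  filter_upwards [(ContinuousLinearMap.mul ℂ ℂ).coeFn_holder (r := 2)
    ((memLp_top_const (1 : ℂ)).indicator hS).toLp u,
    ((memLp_top_const (μ := ν) (1 : ℂ)).indicator hS).coeFn_toLp] with t h_mul h_indicator
  refine h_mul.trans ?_
  by_cases ht : t ∈ S <;> simp [h_indicator, ht]

theorem indicatorMul_inter (hS : MeasurableSet S) (hT : MeasurableSet T) :
    indicatorMul ν (hS.inter hT) = indicatorMul ν hS * indicatorMul ν hT := by
  ext u : 1
  ext1
  filter_upwards [coeFn_indicatorMul hS (indicatorMul ν hT u), coeFn_indicatorMul hT u,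
    coeFn_indicatorMul (hS.inter hT) u] with t hST hTu h_inter
  rw [h_inter, ← Set.indicator_indicator, mul_apply_eq_comp, hST]
  by_cases ht : t ∈ S <;> simp [ht, hTu]

theorem isStarProjection_indicatorMul (hS : MeasurableSet S) :
    IsStarProjection (indicatorMul ν hS) where
  isIdempotentElem := by
    rw [IsIdempotentElem, ← indicatorMul_inter]
    simp only [Set.inter_self]
  isSelfAdjoint := by
    rw [ContinuousLinearMap.isSelfAdjoint_iff_isSymmetric]
    intro u v
    refine integral_congr_ae ?_
    filter_upwards [coeFn_indicatorMul hS u, coeFn_indicatorMul hS v] with t hu hv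
    by_cases ht : t ∈ S <;> simp [hu, hv, ht]

theorem enorm_indicatorMul_sq (hS : MeasurableSet S) (u : Lp ℂ 2 ν) :
    ‖indicatorMul ν hS u‖ₑ ^ 2 = ∫⁻ t in S, ‖u t‖ₑ ^ 2 ∂ν := by
  rw [Lp.enorm_def, eLpNorm_congr_ae (coeFn_indicatorMul hS u),
    eLpNorm_indicator_eq_eLpNorm_restrict hS, sq_eLpNorm_two]

theorem indicatorMul_empty : indicatorMul ν MeasurableSet.empty = 0 := by
  ext u : 1
  simpa using enorm_indicatorMul_sq MeasurableSet.empty u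

theorem indicatorMul_univ : indicatorMul ν MeasurableSet.univ = 1 := by
  ext u : 1
  ext1
  filter_upwards [coeFn_indicatorMul MeasurableSet.univ u] with t ht
  rw [ht, Set.indicator_univ, one_apply_eq_self]

theorem indicatorMul_iUnion_sub_sum {ι : Type*} [Countable ι] {S : ι → Set α}
    (hS : ∀ i, MeasurableSet (S i)) (hd : Pairwise (Function.onFun Disjoint S)) (u : Lp ℂ 2 ν)
    (s : Finset ι) :
    indicatorMul ν (.iUnion hS) u - ∑ i ∈ s, indicatorMul ν (hS i) u =
      indicatorMul ν (.iUnion fun i : {i // i ∉ s} => hS i) u := by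
  have union_eq : ⋃ i, S i = (⋃ i ∈ s, S i) ∪ ⋃ i : {i // i ∉ s}, S i := by
    ext t
    simp only [Set.mem_union, Set.mem_iUnion, Subtype.exists, exists_prop, ← exists_or,
      ← or_and_right, em, true_and]
  have disjoint : Disjoint (⋃ i ∈ s, S i) (⋃ i : {i // i ∉ s}, S i) := by
    simp only [Set.disjoint_iUnion_left, Set.disjoint_iUnion_right, Subtype.forall]
    exact fun i hi j hj => hd fun h => hi (h ▸ hj)
  ext1
  filter_upwards [Lp.coeFn_sub (indicatorMul ν (.iUnion hS) u) (∑ i ∈ s, indicatorMul ν (hS i) u),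
    Lp.coeFn_fun_finsetSum s fun i => indicatorMul ν (hS i) u,
    coeFn_indicatorMul (.iUnion hS) u, ae_all_iff.2 fun i => coeFn_indicatorMul (hS i) u,
    coeFn_indicatorMul (.iUnion fun i : {i // i ∉ s} => hS i) u] with t hsub hsum hU hi hV
  rw [hsub, Pi.sub_apply, hsum, hU, hV, Finset.sum_congr rfl fun i _ => hi i,
    ← Finset.indicator_biUnion_apply s S (fun i _ j _ h => hd h), union_eq,
    Set.indicator_union_of_disjoint disjoint, add_sub_cancel_left]

theorem hasSum_indicatorMul {ι : Type*} [Countable ι] {S : ι → Set α}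
    (hS : ∀ i, MeasurableSet (S i)) (hd : Pairwise (Function.onFun Disjoint S)) (u : Lp ℂ 2 ν) :
    HasSum (fun i => indicatorMul ν (hS i) u) (indicatorMul ν (.iUnion hS) u) := by
  have h_tail (s : Finset ι) :
      ‖∑ i ∈ s, indicatorMul ν (hS i) u - indicatorMul ν (.iUnion hS) u‖ₑ ^ 2 =
        ∑' i : {i // i ∉ s}, ‖indicatorMul ν (hS i) u‖ₑ ^ 2 := by
    rw [enorm_sub_rev, indicatorMul_iUnion_sub_sum hS hd, enorm_indicatorMul_sq,
      lintegral_iUnion (s := fun i : {i // i ∉ s} => S i) (fun i => hS i)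
        fun i j h => hd (Subtype.coe_injective.ne h)]
    simp only [enorm_indicatorMul_sq]
  have h_finite : ∑' i, ‖indicatorMul ν (hS i) u‖ₑ ^ 2 ≠ ∞ := by
    simp only [enorm_indicatorMul_sq]
    rw [← lintegral_iUnion hS hd, ← enorm_indicatorMul_sq (.iUnion hS)]
    exact ENNReal.pow_ne_top enorm_ne_top
  have h_sqrt := ((ENNReal.continuous_rpow_const (y := ((2 : ℕ) : ℝ)⁻¹)).tendsto 0).comp
    (ENNReal.tendsto_tsum_compl_atTop_zero h_finite)
  rw [ENNReal.zero_rpow_of_pos (by norm_num)] at h_sqrt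
  rw [HasSum, SummationFilter.unconditional_filter, tendsto_iff_edist_tendsto_0]
  refine h_sqrt.congr fun s => ?_
  rw [Function.comp_apply, ← h_tail, ENNReal.pow_rpow_inv_natCast two_ne_zero, edist_eq_enorm_sub]

end IndicatorMul

section Multiplication

variable {α : Type*} [MeasurableSpace α] {ν : Measure α} {a : α → ℂ}

open Classical in
/-- The resolution of the identity of the operator of multiplication by `a` on `L²`. -/
noncomputable def multiplicationResolution (ν : Measure α) (ha : Measurable a) :
    ResolutionOfIdentity (Lp ℂ 2 ν) where
  proj S := if hS : MeasurableSet S then indicatorMul ν (ha hS) else 0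
  isStarProjection S hS := by
    rw [dif_pos hS]
    exact isStarProjection_indicatorMul (ha hS)
  empty := by
    rw [dif_pos .empty]
    exact indicatorMul_empty
  univ := by
    rw [dif_pos .univ]
    exact indicatorMul_univ
  inter S S' hS hS' := by
    rw [dif_pos hS, dif_pos hS', dif_pos (hS.inter hS')]
    exact indicatorMul_inter (ha hS) (ha hS')
  iUnion S hS hd u := by
    simp only [hS, MeasurableSet.iUnion hS, dif_pos, Set.preimage_iUnion]
    exact hasSum_indicatorMul (fun n => ha (hS n)) (fun m n hmn => (hd hmn).preimage a) u

theorem multiplicationResolution_proj (ha : Measurable a) {S : Set ℂ} (hS : MeasurableSet S) :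
    (multiplicationResolution ν ha).proj S = indicatorMul ν (ha hS) :=
  dif_pos hS

theorem diagMeasure_multiplicationResolution (ha : Measurable a) (u : Lp ℂ 2 ν) :
    (multiplicationResolution ν ha).diagMeasure u =
      (ν.withDensity fun t => ‖u t‖ₑ ^ 2).map a := by
  ext S hS
  rw [Measure.map_apply ha hS, ResolutionOfIdentity.diagMeasure_apply _ hS,
    multiplicationResolution_proj ha hS, enorm_indicatorMul_sq, withDensity_apply _ (ha hS)]

theorem eventually_notMem_multiplicationResolution [SigmaFinite ν] (ha : Measurable a)
    {S : Set ℂ} (hS : MeasurableSet S) :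
    (∀ᶠ z in (multiplicationResolution ν ha).ae, z ∉ S) ↔ ν (a ⁻¹' S) = 0 := by
  rw [ResolutionOfIdentity.eventually_notMem_ae_iff _ hS, multiplicationResolution_proj ha hS]
  refine ⟨fun h => ?_, fun h u => ?_⟩
  · by_contra h_pos
    obtain ⟨T, hT, hTS, hT_pos, hT_lt⟩ :=
      Measure.exists_subset_measure_lt_top (ha hS) (pos_iff_ne_zero.2 h_pos)
    have h_zero := h (indicatorConstLp 2 hT hT_lt.ne (1 : ℂ))
    have h_coeFn := coeFn_indicatorMul (ha hS) (indicatorConstLp 2 hT hT_lt.ne (1 : ℂ))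
    rw [h_zero] at h_coeFn
    refine hT_pos.ne' (measure_eq_zero_iff_ae_notMem.2 ?_)
    filter_upwards [h_coeFn, indicatorConstLp_coeFn (hs := hT) (hμs := hT_lt.ne) (c := (1 : ℂ)),
      Lp.coeFn_zero ℂ 2 ν] with t h_indicator hT_one h_zero ht
    rw [h_zero, Set.indicator_of_mem (hTS ht), hT_one, Set.indicator_of_mem ht] at h_indicator
    exact zero_ne_one h_indicator
  · simpa [Measure.restrict_eq_zero.2 h] using enorm_indicatorMul_sq (ha hS) u

theorem essRange_multiplicationResolution [TopologicalSpace α] [OpensMeasurableSpace α]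
    [SigmaFinite ν] [ν.IsOpenPosMeasure] (ha : Continuous a) :
    (multiplicationResolution ν ha.measurable).essRange (fun z => z) = closure (Set.range a) := by
  refine (ResolutionOfIdentity.essRange_subset isClosed_closure ?_).antisymm
    (closure_minimal ?_ ResolutionOfIdentity.isClosed_essRange)
  · have h := (eventually_notMem_multiplicationResolution (ν := ν) ha.measurable
      isClosed_closure.measurableSet.compl (S := (closure (Set.range a))ᶜ)).2 <| by
        rw [Set.preimage_compl, Set.preimage_eq_univ_iff.2 subset_closure]
        simp
    simpa using h
  · rintro _ ⟨t, rfl⟩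
    by_contra h
    obtain ⟨δ, hδ, h⟩ := ResolutionOfIdentity.notMem_essRange.1 h
    have h_null : ν (a ⁻¹' Metric.eball (a t) δ) = 0 :=
      (eventually_notMem_multiplicationResolution ha.measurable
        Metric.isOpen_eball.measurableSet).1 (by simpa [edist_eq_enorm_sub] using h)
    exact ((Metric.isOpen_eball.preimage ha).measure_pos ν ⟨t, Metric.mem_eball_self hδ⟩).ne' h_null

end Multiplication

namespace ResolutionOfIdentity

section Comap

variable {H K : Type*} [NormedAddCommGroup H] [InnerProductSpace ℂ H] [CompleteSpace H]
  [NormedAddCommGroup K] [InnerProductSpace ℂ K] [CompleteSpace K]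
  (E : ResolutionOfIdentity K) (U : H ≃ₗᵢ[ℂ] K)

/-- The resolution of the identity `U⁻¹ E U` for a unitary map `U`. -/
noncomputable def comap : ResolutionOfIdentity H where
  proj S := U.symm.conjStarAlgEquiv (E.proj S)
  isStarProjection S hS := (E.isStarProjection S hS).map U.symm.conjStarAlgEquiv
  empty := by rw [E.empty, map_zero]
  univ := by rw [E.univ, map_one]
  inter S S' hS hS' := by rw [E.inter S S' hS hS', map_mul]
  iUnion S hS hd x :=
    (U.symm.toContinuousLinearEquiv : K →L[ℂ] H).hasSum (E.iUnion S hS hd (U x))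

theorem diagMeasure_comap (x : H) : (E.comap U).diagMeasure x = E.diagMeasure (U x) := by
  ext S hS
  rw [diagMeasure_apply _ hS, diagMeasure_apply _ hS]
  exact congrArg (fun r => r ^ 2) (U.symm.enorm_map _)

theorem ae_comap : (E.comap U).ae = E.ae := by
  simp only [ae, diagMeasure_comap]
  exact U.surjective.iSup_comp fun y => MeasureTheory.ae (E.diagMeasure y)

theorem essRange_comap (f : ℂ → ℂ) : (E.comap U).essRange f = E.essRange f := by
  rw [essRange, essRange, ae_comap]

end Comap

section

variable {H α : Type*} [NormedAddCommGroup H] [InnerProductSpace ℂ H] [CompleteSpace H]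
  [MeasurableSpace α] {ν : Measure α} {a : α → ℂ} {A : H →ₗ.[ℂ] H}

theorem isIntegral_comap_multiplicationResolution (U : H ≃ₗᵢ[ℂ] Lp ℂ 2 ν) (ha : Measurable a)
    (hdom : ∀ x, x ∈ A.domain ↔ MemLp (fun t => a t * U x t) 2 ν)
    (hA : ∀ x : A.domain, U (A x) =ᵐ[ν] fun t => a t * U x t) :
    ((multiplicationResolution ν ha).comap U).IsIntegral (fun z => z) A := by
  have hu (x : H) : AEMeasurable (fun t => ‖U x t‖ₑ ^ 2) ν :=
    (Lp.aestronglyMeasurable _).enorm.pow_const 2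
  refine ⟨fun x => ?_, fun x => ?_⟩
  · rw [diagMeasure_comap, diagMeasure_multiplicationResolution, lintegral_map (by fun_prop) ha,
      lintegral_withDensity_eq_lintegral_mul₀ (hu x) (by fun_prop), hdom,
      ← lintegral_enorm_sq_lt_top_iff
        (by exact ha.aestronglyMeasurable.mul (Lp.aestronglyMeasurable _))]
    simp only [Pi.mul_apply, enorm_mul, mul_pow, mul_comm]
  · rw [diagMeasure_comap, diagMeasure_multiplicationResolution,
      integral_map ha.aemeasurable (by fun_prop), integral_withDensity_eq_integral_toReal_smul₀
      (hu _) (Eventually.of_forall fun t => by simp), ← U.inner_map_map, L2.inner_def]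
    refine integral_congr_ae ?_
    filter_upwards [hA x] with t ht
    rw [ht, ENNReal.toReal_pow, toReal_enorm, Complex.real_smul, RCLike.inner_apply, mul_assoc,
      RCLike.mul_conj]
    push_cast
    exact mul_comm _ _

end
end ResolutionOfIdentity

/-! ### Weak derivatives and absolute continuity -/

section WeakDerivative

open scoped ContDiff

theorem intervalIntegrable_of_locallyIntegrable {F : Type*} [NormedAddCommGroup F] {f : ℝ → F}
    (hf : LocallyIntegrable f) (a b : ℝ) : IntervalIntegrable f volume a b :=
  intervalIntegrable_iff.2
    ((hf.integrableOn_isCompact isCompact_uIcc).mono_set Set.uIoc_subset_uIcc)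

theorem isLocallyAC_ofReal_integral {k : ℝ → ℝ} (hk : LocallyIntegrable k) :
    IsLocallyAC fun x => ((∫ t in (0 : ℝ)..x, k t : ℝ) : ℂ) := by
  intro a b
  have h_le : min 0 (min a b) ≤ max 0 (max a b) := (min_le_left _ _).trans (le_max_left _ _)
  have h_zero : (0 : ℝ) ∈ Set.uIcc (min 0 (min a b)) (max 0 (max a b)) :=
    Set.uIcc_of_le h_le ▸ ⟨min_le_left _ _, le_max_left _ _⟩
  have h_sub : Set.uIcc a b ⊆ Set.uIcc (min 0 (min a b)) (max 0 (max a b)) :=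
    Set.uIcc_of_le h_le ▸ Set.Icc_subset_Icc (min_le_right _ _) (le_max_right _ _)
  have h_real : AbsolutelyContinuousOnInterval (fun x => ∫ t in (0 : ℝ)..x, k t) a b :=
    ((intervalIntegrable_of_locallyIntegrable hk _
      _).absolutelyContinuousOnInterval_intervalIntegral h_zero).mono h_sub
  simpa only [AbsolutelyContinuousOnInterval, Complex.isometry_ofReal.dist_eq] using h_real

theorem isLocallyAC_integral {h : ℝ → ℂ} (hh : LocallyIntegrable h) :
    IsLocallyAC fun x => ∫ t in (0 : ℝ)..x, h t := by
  have h_re : LocallyIntegrable fun t => (h t).re := fun x =>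
    (hh x).imp fun _ hs => ⟨hs.1, hs.2.re⟩
  have h_im : LocallyIntegrable fun t => (h t).im := fun x =>
    (hh x).imp fun _ hs => ⟨hs.1, hs.2.im⟩
  have h_split (x : ℝ) : ∫ t in (0 : ℝ)..x, h t =
      (∫ t in (0 : ℝ)..x, (h t).re : ℝ) + Complex.I • ((∫ t in (0 : ℝ)..x, (h t).im : ℝ) : ℂ) := by
    have hi_re := intervalIntegrable_of_locallyIntegrable h_re 0 x
    have hi_im := intervalIntegrable_of_locallyIntegrable h_im 0 x
    rw [← intervalIntegral.integral_ofReal, ← intervalIntegral.integral_ofReal, smul_eq_mul,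
      ← intervalIntegral.integral_const_mul, ← intervalIntegral.integral_add]
    · simp only [mul_comm Complex.I, Complex.re_add_im]
    · exact ⟨hi_re.1.ofReal, hi_re.2.ofReal⟩
    · exact IntervalIntegrable.const_mul ⟨hi_im.1.ofReal, hi_im.2.ofReal⟩ _
  intro a b
  rw [funext h_split]
  exact (isLocallyAC_ofReal_integral h_re a b).add
    ((isLocallyAC_ofReal_integral h_im a b).const_smul Complex.I)

theorem isLocallyAC_of_contDiff {g : ℝ → ℂ} (hg : ContDiff ℝ 1 g) : IsLocallyAC g :=
  fun _ _ => hg.contDiffOn.absolutelyContinuousOnInterval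

namespace IsLocallyAC

variable {g h : ℝ → ℂ}

theorem mul (hg : IsLocallyAC g) (hh : IsLocallyAC h) : IsLocallyAC fun x => g x * h x :=
  fun a b => (hg a b).smul (hh a b)

theorem ae_hasDerivAt (hg : IsLocallyAC g) : ∀ᵐ t, HasDerivAt g (deriv g t) t :=
  hg.ae_differentiableAt.mono fun _ ht => ht.hasDerivAt

theorem eq_add_integral (hg : IsLocallyAC g) (hh : LocallyIntegrable h)
    (hd : ∀ᵐ t, HasDerivAt g (h t) t) (x : ℝ) : g x = g 0 + ∫ t in (0 : ℝ)..x, h t := by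
  obtain ⟨C, hC⟩ := ((hg 0 x).sub (isLocallyAC_integral hh 0 x)).const_of_ae_hasDerivAt_zero (by
    filter_upwards [hd, LocallyIntegrable.ae_hasDerivAt_integral hh] with t hgt hht _
    simpa using hgt.sub (hht 0))
  have h_zero := hC 0 Set.left_mem_uIcc
  have hx := hC x Set.right_mem_uIcc
  simp only [Pi.sub_apply, intervalIntegral.integral_same, sub_zero] at h_zero hx
  rw [h_zero, ← hx, sub_add_cancel]

theorem integral_deriv_eq_zero (hg : IsLocallyAC g) (hgi : Integrable g) (hh : Integrable h)
    (hd : ∀ᵐ t, HasDerivAt g (h t) t) : ∫ t, h t = 0 := by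
  have h_eq (x : ℝ) : ∫ t in -x..x, h t = g x - g (-x) := by
    have hi := intervalIntegrable_of_locallyIntegrable hh.locallyIntegrable
    rw [hg.eq_add_integral hh.locallyIntegrable hd x,
      hg.eq_add_integral hh.locallyIntegrable hd (-x), add_sub_add_left_eq_sub,
      intervalIntegral.integral_interval_sub_left (hi _ _) (hi _ _)]
  have h_lim : Tendsto (fun x => g x - g (-x)) atTop (𝓝 (∫ t, h t)) := by
    simpa only [← h_eq] using!
      intervalIntegral_tendsto_integral hh tendsto_neg_atTop_atBot tendsto_id
  refine ((hgi.sub hgi.comp_neg).integrableAtFilter atTop).eq_zero_of_tendsto (fun s hs => ?_)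
    h_lim
  obtain ⟨b, hb⟩ := mem_atTop_sets.1 hs
  exact top_le_iff.1 (Real.volume_Ici (a := b) ▸ measure_mono hb)

theorem integral_mul_eq_neg_integral_mul {u v u' v' : ℝ → ℂ} (hu : IsLocallyAC u)
    (hv : IsLocallyAC v) (hu' : ∀ᵐ t, HasDerivAt u (u' t) t) (hv' : ∀ᵐ t, HasDerivAt v (v' t) t)
    (h_uv : Integrable fun t => u t * v t) (h_uv' : Integrable fun t => u t * v' t)
    (h_u'v : Integrable fun t => u' t * v t) :
    ∫ t, u t * v' t = -∫ t, u' t * v t := by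
  have h_zero := (hu.mul hv).integral_deriv_eq_zero h_uv (h_u'v.add h_uv') (by
    filter_upwards [hu', hv'] with t hut hvt using hut.mul hvt)
  simp only [Pi.add_apply] at h_zero
  rw [integral_add h_u'v h_uv'] at h_zero
  exact eq_neg_of_add_eq_zero_right h_zero

end IsLocallyAC

theorem hasDerivAt_integral_Iic {η : ℝ → ℝ} (hη : Continuous η) (hi : Integrable η) (x : ℝ) :
    HasDerivAt (fun x => ∫ t in Set.Iic x, η t) (η x) x := by
  have h_eq (x : ℝ) :
      ∫ t in Set.Iic x, η t = (∫ t in Set.Iic 0, η t) + ∫ t in (0 : ℝ)..x, η t := by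
    rw [← intervalIntegral.integral_Iic_sub_Iic hi.integrableOn hi.integrableOn]
    ring
  rw [funext h_eq]
  exact (intervalIntegral.integral_hasDerivAt_right hi.intervalIntegrable
    (hη.stronglyMeasurableAtFilter _ _) hη.continuousAt).const_add _

theorem hasCompactSupport_integral_Iic {η : ℝ → ℝ} (hc : HasCompactSupport η)
    (h_zero : ∫ t, η t = 0) : HasCompactSupport fun x => ∫ t in Set.Iic x, η t := by
  obtain ⟨R, hR⟩ := hc.isCompact.isBounded.subset_closedBall (0 : ℝ)
  rw [Real.closedBall_eq_Icc, zero_sub, zero_add] at hR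
  have h_out (t : ℝ) (ht : t ∉ Set.Icc (-R) R) : η t = 0 :=
    image_eq_zero_of_notMem_tsupport fun h => ht (hR h)
  refine HasCompactSupport.intro (isCompact_Icc (a := -R) (b := R)) fun x hx => ?_
  rcases not_and_or.1 hx with hx | hx
  · refine setIntegral_eq_zero_of_forall_eq_zero fun t ht => h_out t fun htR => hx ?_
    exact htR.1.trans ht
  · rw [← h_zero]
    refine setIntegral_eq_integral_of_forall_compl_eq_zero fun t ht => h_out t fun htR => ht ?_
    exact htR.2.trans (not_le.1 hx).le

theorem exists_hasCompactSupport_deriv_eq {η : ℝ → ℝ} (hη : ContDiff ℝ ∞ η)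
    (hc : HasCompactSupport η) (h_zero : ∫ t, η t = 0) :
    ∃ ψ : ℝ → ℝ, ContDiff ℝ ∞ ψ ∧ HasCompactSupport ψ ∧ deriv ψ = η := by
  have h_deriv := hasDerivAt_integral_Iic hη.continuous
    (hη.continuous.integrable_of_hasCompactSupport hc)
  have h_eq : (deriv fun x => ∫ t in Set.Iic x, η t) = η := funext fun x => (h_deriv x).deriv
  refine ⟨_, ?_, hasCompactSupport_integral_Iic hc h_zero, h_eq⟩
  rw [contDiff_infty_iff_deriv, h_eq]
  exact ⟨fun x => (h_deriv x).differentiableAt, hη⟩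

/-- The lemma of du Bois-Reymond. -/
theorem exists_ae_eq_const_of_integral_deriv_smul_eq_zero {k : ℝ → ℂ} (hk : LocallyIntegrable k)
    (h : ∀ ψ : ℝ → ℝ, ContDiff ℝ ∞ ψ → HasCompactSupport ψ → ∫ t, deriv ψ t • k t = 0) :
    ∃ C : ℂ, ∀ᵐ t, k t = C := by
  obtain ⟨χ, hχ, hχc, hχ_one⟩ : ∃ χ : ℝ → ℝ,
      ContDiff ℝ ∞ χ ∧ HasCompactSupport χ ∧ ∫ t, χ t = 1 :=
    let b : ContDiffBump (0 : ℝ) := ⟨1, 2, one_pos, one_lt_two⟩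
    ⟨b.normed volume, b.contDiff_normed, b.hasCompactSupport_normed, b.integral_normed⟩
  have hki {φ : ℝ → ℝ} (hφ : ContDiff ℝ ∞ φ) (hφc : HasCompactSupport φ) :
      Integrable fun t => φ t • k t :=
    hk.integrable_smul_left_of_hasCompactSupport hφ.continuous hφc
  refine ⟨∫ t, χ t • k t, ae_eq_of_integral_contDiff_smul_eq hk (locallyIntegrable_const _) ?_⟩
  intro φ hφ hφc
  have hφi : Integrable φ := hφ.continuous.integrable_of_hasCompactSupport hφc
  have hχi : Integrable χ := hχ.continuous.integrable_of_hasCompactSupport hχc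
  -- `φ - (∫ φ) χ` has integral zero, hence is the derivative of a test function.
  obtain ⟨ψ, hψ, hψc, hψd⟩ := exists_hasCompactSupport_deriv_eq
    (η := fun t => φ t - (∫ s, φ s) * χ t) (hφ.sub (contDiff_const.mul hχ))
    (hφc.sub hχc.mul_left) (by
      rw [integral_sub hφi (hχi.const_mul _), integral_const_mul, hχ_one, mul_one, sub_self])
  have h_test := h ψ hψ hψc
  simp only [hψd, sub_smul, mul_smul] at h_test
  rw [integral_sub (hki hφ hφc) ((hki hχ hχc).fun_smul _), integral_smul, sub_eq_zero] at h_test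
  rw [h_test, integral_smul_const]

theorem exists_isLocallyAC_of_weak_deriv {f h : ℝ → ℂ} (hf : LocallyIntegrable f)
    (hh : LocallyIntegrable h)
    (hw : ∀ ψ : ℝ → ℝ, ContDiff ℝ ∞ ψ → HasCompactSupport ψ →
      ∫ t, ψ t • h t = -∫ t, deriv ψ t • f t) :
    ∃ g, IsLocallyAC g ∧ f =ᵐ[volume] g ∧ ∀ᵐ t, HasDerivAt g (h t) t := by
  set G : ℝ → ℂ := fun x => ∫ t in (0 : ℝ)..x, h t
  have hG : IsLocallyAC G := isLocallyAC_integral hh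
  have hG' : ∀ᵐ t, HasDerivAt G (h t) t :=
    (LocallyIntegrable.ae_hasDerivAt_integral hh).mono fun _ ht => ht 0
  have hGi : LocallyIntegrable G := hG.continuous.locallyIntegrable
  obtain ⟨C, hC⟩ := exists_ae_eq_const_of_integral_deriv_smul_eq_zero (hf.sub hGi) (by
    intro ψ hψ hψc
    have hψ' : ContDiff ℝ 1 ψ := hψ.of_le (by norm_cast)
    have hdc : Continuous (deriv ψ) := hψ'.continuous_deriv le_rfl
    have h_parts : ∫ t, ψ t • h t = -∫ t, deriv ψ t • G t := by
      simp only [Complex.real_smul]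
      refine (isLocallyAC_of_contDiff (Complex.ofRealCLM.contDiff.comp
        hψ')).integral_mul_eq_neg_integral_mul hG (.of_forall fun t => ?_) hG' ?_ ?_ ?_
      · exact (hψ'.differentiable one_ne_zero t).hasDerivAt.ofReal_comp
      · exact hGi.integrable_smul_left_of_hasCompactSupport hψ.continuous hψc
      · exact hh.integrable_smul_left_of_hasCompactSupport hψ.continuous hψc
      · exact hGi.integrable_smul_left_of_hasCompactSupport hdc hψc.deriv
    simp only [Pi.sub_apply, smul_sub]
    rw [integral_sub (hf.integrable_smul_left_of_hasCompactSupport hdc hψc.deriv)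
      (hGi.integrable_smul_left_of_hasCompactSupport hdc hψc.deriv), sub_eq_zero, ← neg_inj,
      ← hw ψ hψ hψc, h_parts])
  refine ⟨fun x => G x + C, fun a b => (hG a b).add (isLocallyAC_of_contDiff contDiff_const a b),
    ?_, hG'.mono fun _ ht => ht.add_const C⟩
  filter_upwards [hC] with t ht
  rw [← ht, Pi.sub_apply, add_sub_cancel]

end WeakDerivative

/-! ### Differentiation and the Fourier transform on `L²(ℝ)` -/

section FourierDerivative

open FourierTransform SchwartzMap TemperedDistribution LineDeriv
open scoped ContDiff Real

variable {f h : Lp ℂ 2 (volume : Measure ℝ)}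

theorem schwartz_lineDerivOp_one_apply (φ : 𝓢(ℝ, ℂ)) (x : ℝ) : (∂_{(1 : ℝ)} φ) x = deriv φ x := by
  rw [SchwartzMap.lineDerivOp_apply_eq_fderiv, fderiv_apply_one_eq_deriv]

theorem isLocallyAC_schwartz (φ : 𝓢(ℝ, ℂ)) : IsLocallyAC φ :=
  isLocallyAC_of_contDiff (φ.smooth 1)

theorem eq_lineDeriv_iff_weak_deriv :
    (h : 𝓢'(ℝ, ℂ)) = ∂_{(1 : ℝ)} (f : 𝓢'(ℝ, ℂ)) ↔
      ∀ φ : 𝓢(ℝ, ℂ), ∫ t, φ t * h t = -∫ t, deriv φ t * f t := by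
  have h_apply (φ : 𝓢(ℝ, ℂ)) :
      (∂_{(1 : ℝ)} (f : 𝓢'(ℝ, ℂ))) φ = -∫ t, deriv φ t * f t := by
    rw [TemperedDistribution.lineDerivOp_apply_apply, map_neg, Lp.toTemperedDistribution_apply]
    simp only [schwartz_lineDerivOp_one_apply, smul_eq_mul]
  have h_pair (φ : 𝓢(ℝ, ℂ)) : (h : 𝓢'(ℝ, ℂ)) φ = ∫ t, φ t * h t :=
    Lp.toTemperedDistribution_apply h φ
  simp only [← h_apply, ← h_pair]
  exact ⟨fun H φ => by rw [H], fun H => by ext φ; exact H φ⟩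

theorem IsLocallyAC.integral_schwartz_mul_deriv {g : ℝ → ℂ} (hg : IsLocallyAC g)
    (hfg : f =ᵐ[volume] g) (hhg : h =ᵐ[volume] deriv g) (φ : 𝓢(ℝ, ℂ)) :
    ∫ t, φ t * h t = -∫ t, deriv φ t * f t := by
  have hφ' : MemLp (deriv φ) 2 volume := by
    simpa only [← schwartz_lineDerivOp_one_apply] using! (∂_{(1 : ℝ)} φ).memLp 2 volume
  have hgL : MemLp g 2 volume := (Lp.memLp f).ae_eq hfg
  rw [integral_congr_ae (hfg.mono fun t ht => congrArg (deriv φ t * ·) ht)]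
  refine (isLocallyAC_schwartz φ).integral_mul_eq_neg_integral_mul hg
    (.of_forall fun t => φ.differentiableAt.hasDerivAt) ?_ ((φ.memLp 2 volume).integrable_mul hgL)
    ((φ.memLp 2 volume).integrable_mul (Lp.memLp h)) (hφ'.integrable_mul hgL)
  filter_upwards [hg.ae_hasDerivAt, hhg] with t ht hht
  rwa [hht]

theorem exists_isLocallyAC_iff_eq_lineDeriv :
    (∃ g : ℝ → ℂ, IsLocallyAC g ∧ f =ᵐ[volume] g ∧ h =ᵐ[volume] deriv g) ↔
      (h : 𝓢'(ℝ, ℂ)) = ∂_{(1 : ℝ)} (f : 𝓢'(ℝ, ℂ)) := by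
  rw [eq_lineDeriv_iff_weak_deriv]
  refine ⟨fun ⟨g, hg, hfg, hhg⟩ => hg.integral_schwartz_mul_deriv hfg hhg, fun H => ?_⟩
  obtain ⟨g, hg, hfg, hd⟩ := exists_isLocallyAC_of_weak_deriv
    ((Lp.memLp f).locallyIntegrable one_le_two) ((Lp.memLp h).locallyIntegrable one_le_two) (by
    intro ψ hψ hψc
    have hc : HasCompactSupport fun x => (ψ x : ℂ) := hψc.comp_left Complex.ofReal_zero
    let Ψ : 𝓢(ℝ, ℂ) := hc.toSchwartzMap (Complex.ofRealCLM.contDiff.comp hψ)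
    have hΨ (t : ℝ) : deriv Ψ t = deriv ψ t :=
      (hψ.differentiable (by simp) t).hasDerivAt.ofReal_comp.deriv
    simpa only [Complex.real_smul, hΨ] using! H Ψ)
  exact ⟨g, hg, hfg, hd.mono fun _ ht => ht.deriv.symm⟩

theorem fourier_lineDeriv_toTemperedDistribution_apply (f : Lp ℂ 2 (volume : Measure ℝ))
    (φ : 𝓢(ℝ, ℂ)) :
    (𝓕 (∂_{(1 : ℝ)} (f : 𝓢'(ℝ, ℂ)))) φ =
      ∫ ξ, φ ξ * (2 * π * Complex.I * ξ * (𝓕 f : Lp ℂ 2 (volume : Measure ℝ)) ξ) := by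
  have h_growth : (fun x : ℝ => ((inner ℝ x 1 : ℝ) : ℂ)).HasTemperateGrowth := by fun_prop
  rw [TemperedDistribution.fourier_lineDerivOp_eq, Lp.fourier_toTemperedDistribution_eq]
  simp only [smul_apply, TemperedDistribution.smulLeftCLM_apply_apply,
    Lp.toTemperedDistribution_apply, SchwartzMap.smulLeftCLM_apply_apply h_growth, smul_eq_mul]
  rw [← integral_const_mul]
  congr 1 with ξ
  simp only [RCLike.inner_apply, Real.ringHom_apply, one_mul]
  ring

theorem fourier_toTemperedDistribution_apply (h : Lp ℂ 2 (volume : Measure ℝ)) (φ : 𝓢(ℝ, ℂ)) :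
    (𝓕 (h : 𝓢'(ℝ, ℂ))) φ = ∫ ξ, φ ξ * (𝓕 h : Lp ℂ 2 (volume : Measure ℝ)) ξ := by
  rw [Lp.fourier_toTemperedDistribution_eq, Lp.toTemperedDistribution_apply]
  rfl

theorem eq_lineDeriv_iff_fourier :
    (h : 𝓢'(ℝ, ℂ)) = ∂_{(1 : ℝ)} (f : 𝓢'(ℝ, ℂ)) ↔
      ∀ᵐ ξ : ℝ, (𝓕 h : Lp ℂ 2 (volume : Measure ℝ)) ξ =
        2 * π * Complex.I * ξ * (𝓕 f : Lp ℂ 2 (volume : Measure ℝ)) ξ := by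
  have h_loc (u : Lp ℂ 2 (volume : Measure ℝ)) : LocallyIntegrable u :=
    (Lp.memLp u).locallyIntegrable one_le_two
  refine ⟨fun H => ?_, fun H => ?_⟩
  · have h_mul : LocallyIntegrable fun ξ : ℝ =>
        2 * π * Complex.I * ξ * (𝓕 f : Lp ℂ 2 (volume : Measure ℝ)) ξ :=
      locallyIntegrable_iff.2 fun K hK =>
        ((h_loc _).integrableOn_isCompact hK).continuousOn_mul (by fun_prop) hK
    refine ae_eq_of_integral_contDiff_smul_eq (h_loc _) h_mul fun ψ hψ hψc => ?_
    have hc : HasCompactSupport fun x => (ψ x : ℂ) := hψc.comp_left Complex.ofReal_zero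
    have h_test := fourier_toTemperedDistribution_apply h
      (hc.toSchwartzMap (Complex.ofRealCLM.contDiff.comp hψ))
    rw [H, fourier_lineDeriv_toTemperedDistribution_apply] at h_test
    simpa only [Complex.real_smul] using! h_test.symm
  · have h_fourier : 𝓕 (h : 𝓢'(ℝ, ℂ)) = 𝓕 (∂_{(1 : ℝ)} (f : 𝓢'(ℝ, ℂ))) := by
      ext φ
      rw [fourier_toTemperedDistribution_apply, fourier_lineDeriv_toTemperedDistribution_apply]
      exact integral_congr_ae (H.mono fun ξ hξ => congrArg (φ ξ * ·) hξ)
    simpa only [FourierTransform.fourierInv_fourier_eq] using congrArg (𝓕⁻ ·) h_fourier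

theorem exists_isLocallyAC_iff_fourier :
    (∃ g : ℝ → ℂ, IsLocallyAC g ∧ f =ᵐ[volume] g ∧ h =ᵐ[volume] deriv g) ↔
      ∀ᵐ ξ : ℝ, (𝓕 h : Lp ℂ 2 (volume : Measure ℝ)) ξ =
        2 * π * Complex.I * ξ * (𝓕 f : Lp ℂ 2 (volume : Measure ℝ)) ξ :=
  exists_isLocallyAC_iff_eq_lineDeriv.trans eq_lineDeriv_iff_fourier

end FourierDerivative

/-! ### The spectral resolution of the momentum operator -/

section ExpWeight

/-- The function `t ↦ e^{bt}`, with complex values. -/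
noncomputable def expWeight (b t : ℝ) : ℂ := (Real.exp (b * t) : ℂ)

theorem continuous_expWeight (b : ℝ) : Continuous (expWeight b) := by
  unfold expWeight
  fun_prop

theorem expWeight_mul_expWeight_neg (b t : ℝ) : expWeight b t * expWeight (-b) t = 1 := by
  rw [expWeight, expWeight, ← Complex.ofReal_mul, ← Real.exp_add]
  simp

theorem hasDerivAt_expWeight (b t : ℝ) : HasDerivAt (expWeight b) (b * expWeight b t) t := by
  have h_real := ((hasDerivAt_const_mul b (x := t)).exp).ofReal_comp
  rwa [Complex.ofReal_mul, mul_comm] at h_real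

theorem isLocallyAC_expWeight (b : ℝ) : IsLocallyAC (expWeight b) :=
  isLocallyAC_of_contDiff <| Complex.ofRealCLM.contDiff.comp <|
    Real.contDiff_exp.comp <| contDiff_const.mul contDiff_id

variable {c : ℝ} {f : ℝ → ℂ}

theorem enorm_expWeight_sq (b t : ℝ) :
    ‖expWeight b t‖ₑ ^ 2 = ENNReal.ofReal (Real.exp (2 * b * t)) := by
  rw [expWeight, ← ofReal_norm, Complex.norm_real, Real.norm_of_nonneg (Real.exp_pos _).le,
    ← ENNReal.ofReal_pow (Real.exp_pos _).le, ← Real.exp_nat_mul, Nat.cast_ofNat, mul_assoc]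

theorem eLpNorm_expWeight_mul (c : ℝ) (f : ℝ → ℂ) :
    eLpNorm (fun t => expWeight (-c) t * f t) 2 volume = eLpNorm f 2 (weightMeasure c) := by
  refine (ENNReal.pow_right_strictMono two_ne_zero).injective ?_
  simp only [sq_eLpNorm_two]
  rw [weightMeasure, lintegral_withDensity_eq_lintegral_mul_non_measurable _ (by fun_prop)
    (.of_forall fun t => ENNReal.ofReal_lt_top)]
  refine lintegral_congr fun t => ?_
  rw [enorm_mul, mul_pow, enorm_expWeight_sq, Pi.mul_apply, neg_mul, mul_neg]

theorem volume_absolutelyContinuous_weightMeasure (c : ℝ) : volume ≪ weightMeasure c :=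
  withDensity_absolutelyContinuous' (by fun_prop)
    (.of_forall fun _ => (ENNReal.ofReal_pos.2 (Real.exp_pos _)).ne')

theorem memLp_expWeight_mul (hf : MemLp f 2 (weightMeasure c)) :
    MemLp (fun t => expWeight (-c) t * f t) 2 volume :=
  ⟨(continuous_expWeight _).aestronglyMeasurable.mul
    (hf.1.mono_ac (volume_absolutelyContinuous_weightMeasure c)),
    eLpNorm_expWeight_mul c f ▸ hf.2⟩

theorem expWeight_neg_mul_expWeight_mul (b t : ℝ) (w : ℂ) :
    expWeight (-b) t * (expWeight b t * w) = w := by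
  rw [← mul_assoc, mul_comm (expWeight (-b) t), expWeight_mul_expWeight_neg, one_mul]

theorem memLp_weightMeasure (hf : MemLp f 2 volume) :
    MemLp (fun t => expWeight c t * f t) 2 (weightMeasure c) := by
  refine ⟨((continuous_expWeight _).aestronglyMeasurable.mul hf.1).mono_ac
    (withDensity_absolutelyContinuous _ _), ?_⟩
  rw [← eLpNorm_expWeight_mul]
  simpa only [expWeight_neg_mul_expWeight_mul] using hf.2

/-- Multiplication by `e^{-ct}` as a linear isometry `ℍ_c → L²(ℝ)`. -/
noncomputable def weightLI (c : ℝ) : WeightedL2 c →ₗᵢ[ℂ] Lp ℂ 2 (volume : Measure ℝ) where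
  toFun u := (memLp_expWeight_mul (Lp.memLp u)).toLp
  map_add' u v := by
    rw [← MemLp.toLp_add]
    refine MemLp.toLp_congr _ _ ?_
    filter_upwards [(weightMeasure_ae_iff c).1 (Lp.coeFn_add u v)] with t ht
    simp only [ht, Pi.add_apply, mul_add]
  map_smul' a u := by
    rw [RingHom.id_apply, ← MemLp.toLp_const_smul]
    refine MemLp.toLp_congr _ _ ?_
    filter_upwards [(weightMeasure_ae_iff c).1 (Lp.coeFn_smul a u)] with t ht
    simp only [ht, Pi.smul_apply, smul_eq_mul, mul_left_comm]
  norm_map' u := by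
    change ‖(memLp_expWeight_mul (Lp.memLp u)).toLp‖ = _
    rw [Lp.norm_toLp, eLpNorm_expWeight_mul, Lp.norm_def]

theorem coeFn_weightLI (u : WeightedL2 c) :
    weightLI c u =ᵐ[volume] fun t => expWeight (-c) t * u t :=
  (memLp_expWeight_mul (Lp.memLp u)).coeFn_toLp

theorem weightLI_surjective (c : ℝ) : Function.Surjective (weightLI c) := by
  intro v
  refine ⟨(memLp_weightMeasure (Lp.memLp v)).toLp, ?_⟩
  ext1
  filter_upwards [coeFn_weightLI (memLp_weightMeasure (c := c) (Lp.memLp v)).toLp,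
    (weightMeasure_ae_iff c).1 (memLp_weightMeasure (Lp.memLp v)).coeFn_toLp] with t h_coe h_toLp
  rw [h_coe, h_toLp, expWeight_neg_mul_expWeight_mul]

theorem coeFn_weightLI_sub_smul (x y : WeightedL2 c) :
    weightLI c (y - (c : ℂ) • x) =ᵐ[volume] fun t => expWeight (-c) t * (y t - c * x t) := by
  filter_upwards [coeFn_weightLI (y - (c : ℂ) • x),
    (weightMeasure_ae_iff c).1 (Lp.coeFn_sub y ((c : ℂ) • x)),
    (weightMeasure_ae_iff c).1 (Lp.coeFn_smul (c : ℂ) x)] with t h_coe h_sub h_smul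
  rw [h_coe, h_sub, Pi.sub_apply, h_smul, Pi.smul_apply, smul_eq_mul]

theorem mem_shiftGraph_iff_weightLI (x y : WeightedL2 c) :
    (x, y) ∈ shiftGraph c ↔ ∃ g : ℝ → ℂ, IsLocallyAC g ∧
      weightLI c x =ᵐ[volume] g ∧ weightLI c (y - (c : ℂ) • x) =ᵐ[volume] deriv g := by
  constructor
  · rintro ⟨g, hg, hxg, hyg⟩
    rw [EventuallyEq, weightMeasure_ae_iff] at hxg hyg
    refine ⟨fun t => expWeight (-c) t * g t, (isLocallyAC_expWeight _).mul hg, ?_, ?_⟩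
    · filter_upwards [coeFn_weightLI x, hxg] with t h_coe hx
      rw [h_coe, hx]
    · filter_upwards [coeFn_weightLI_sub_smul x y, hxg, hyg, hg.ae_hasDerivAt]
        with t h_coe hx hy h_deriv
      rw [h_coe, ((hasDerivAt_expWeight (-c) t).fun_mul h_deriv).deriv, hx, hy]
      push_cast
      ring
  · rintro ⟨g, hg, hxg, hyg⟩
    refine ⟨fun t => expWeight c t * g t, (isLocallyAC_expWeight _).mul hg, ?_, ?_⟩
    · rw [EventuallyEq, weightMeasure_ae_iff]
      filter_upwards [coeFn_weightLI x, hxg] with t h_coe hx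
      rw [← hx, h_coe, ← mul_assoc, expWeight_mul_expWeight_neg, one_mul]
    · rw [EventuallyEq, weightMeasure_ae_iff]
      filter_upwards [coeFn_weightLI_sub_smul x y, coeFn_weightLI x, hxg, hyg, hg.ae_hasDerivAt]
        with t h_sub h_coe hx hy h_deriv
      rw [((hasDerivAt_expWeight c t).fun_mul h_deriv).deriv, ← hx, ← hy, h_sub, h_coe]
      linear_combination (-(y t)) * expWeight_mul_expWeight_neg c t

end ExpWeight

section Momentum

open FourierTransform
open scoped Real

variable {c : ℝ}

/-- The unitary map `ℍ_c → L²(ℝ)` that diagonalizes the momentum operator. -/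
noncomputable def momentumUnitary (c : ℝ) : WeightedL2 c ≃ₗᵢ[ℂ] Lp ℂ 2 (volume : Measure ℝ) :=
  (LinearIsometryEquiv.ofSurjective (weightLI c) (weightLI_surjective c)).trans
    (Lp.fourierTransformₗᵢ ℝ ℂ)

theorem mem_shiftGraph_iff (x y : WeightedL2 c) :
    (x, y) ∈ shiftGraph c ↔ ∀ᵐ ξ : ℝ, momentumUnitary c (y - (c : ℂ) • x) ξ =
      2 * π * Complex.I * ξ * momentumUnitary c x ξ :=
  (mem_shiftGraph_iff_weightLI x y).trans exists_isLocallyAC_iff_fourier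

theorem mem_domain_momentumOperator (x : WeightedL2 c) :
    x ∈ (momentumOperator c).domain ↔ ∃ y, (x, y) ∈ shiftGraph c := by
  rw [momentumOperator, LinearPMap.smul_domain, LinearPMap.vadd_domain, infinitesimalShift,
    Submodule.toLinearPMap_domain, Submodule.mem_map]
  exact ⟨fun ⟨p, hp, hpx⟩ => ⟨p.2, hpx ▸ hp⟩, fun ⟨y, hy⟩ => ⟨(x, y), hy, rfl⟩⟩

theorem momentumUnitary_momentumOperator (x : (momentumOperator c).domain) :
    momentumUnitary c (momentumOperator c x) =ᵐ[volume]
      fun ξ => 2 * π * ξ * momentumUnitary c (x : WeightedL2 c) ξ := by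
  let y : WeightedL2 c := infinitesimalShift c ⟨x, x.2⟩
  have h_graph : ((x : WeightedL2 c), y) ∈ shiftGraph c :=
    Submodule.mem_graph_toLinearPMap (shiftGraph_single_valued c) ⟨x, x.2⟩
  have h_apply : momentumOperator c x = Complex.I⁻¹ • (y - (c : ℂ) • (x : WeightedL2 c)) := by
    change Complex.I⁻¹ • ((-(c : ℂ)) • (x : WeightedL2 c) + y) = _
    module
  rw [h_apply, map_smul]
  filter_upwards [(mem_shiftGraph_iff _ _).1 h_graph, Lp.coeFn_smul Complex.I⁻¹
    (momentumUnitary c (y - (c : ℂ) • (x : WeightedL2 c)))] with ξ h_fourier h_smul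
  rw [h_smul, Pi.smul_apply, h_fourier, smul_eq_mul]
  field_simp

theorem mem_domain_momentumOperator_iff_memLp (x : WeightedL2 c) :
    x ∈ (momentumOperator c).domain ↔
      MemLp (fun ξ : ℝ => 2 * π * ξ * momentumUnitary c x ξ) 2 volume := by
  refine ⟨fun hx => (Lp.memLp _).ae_eq (momentumUnitary_momentumOperator ⟨x, hx⟩), fun h_mem => ?_⟩
  have h_mem_I := h_mem.const_mul Complex.I
  rw [mem_domain_momentumOperator]
  refine ⟨(momentumUnitary c).symm h_mem_I.toLp + (c : ℂ) • x, ?_⟩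
  rw [mem_shiftGraph_iff, add_sub_cancel_right, LinearIsometryEquiv.apply_symm_apply]
  filter_upwards [h_mem_I.coeFn_toLp] with ξ hξ
  rw [hξ]
  ring

theorem continuous_two_pi_mul : Continuous fun ξ : ℝ => (2 * π * ξ : ℂ) := by fun_prop

/-- The spectral resolution of the momentum operator, which the Fourier transform turns into
multiplication by `2πξ`. -/
noncomputable def momentumResolution (c : ℝ) : ResolutionOfIdentity (WeightedL2 c) :=
  (multiplicationResolution volume continuous_two_pi_mul.measurable).comap (momentumUnitary c)

theorem isIntegral_momentumResolution (c : ℝ) :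
    (momentumResolution c).IsIntegral (fun z => z) (momentumOperator c) :=
  ResolutionOfIdentity.isIntegral_comap_multiplicationResolution _ _
    mem_domain_momentumOperator_iff_memLp momentumUnitary_momentumOperator

theorem injective_two_pi_mul : Function.Injective fun ξ : ℝ => (2 * π * ξ : ℂ) := by
  have h_ne : (2 * π : ℂ) ≠ 0 := by simp [Real.pi_ne_zero]
  exact (mul_right_injective₀ h_ne).comp Complex.ofReal_injective

theorem range_two_pi_mul :
    (Set.range fun ξ : ℝ => (2 * π * ξ : ℂ)) = Set.range ((↑) : ℝ → ℂ) := by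
  refine Set.Subset.antisymm ?_ ?_
  · rintro _ ⟨ξ, rfl⟩
    exact ⟨2 * π * ξ, by push_cast; rfl⟩
  · rintro _ ⟨x, rfl⟩
    refine ⟨x / (2 * π), ?_⟩
    push_cast
    exact mul_div_cancel₀ _ (by simp [Real.pi_ne_zero])

theorem essRange_momentumResolution (c : ℝ) :
    (momentumResolution c).essRange (fun z => z) = Set.range ((↑) : ℝ → ℂ) := by
  rw [momentumResolution, ResolutionOfIdentity.essRange_comap,
    essRange_multiplicationResolution continuous_two_pi_mul, range_two_pi_mul,
    Complex.isometry_ofReal.isClosedEmbedding.isClosed_range.closure_eq]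

theorem eventually_ne_momentumResolution (c : ℝ) (a : ℂ) :
    ∀ᶠ z in (momentumResolution c).ae, z ≠ a := by
  rw [momentumResolution, ResolutionOfIdentity.ae_comap]
  refine (eventually_notMem_multiplicationResolution continuous_two_pi_mul.measurable
    (MeasurableSet.singleton a)).2 (Set.Subsingleton.measure_zero ?_ _)
  exact Set.subsingleton_singleton.preimage injective_two_pi_mul

end Momentum

/-! ### The spectrum of the truncated operators -/

theorem measurable_of_continuousOn_compl_countable {X Y : Type*} [TopologicalSpace X] [T1Space X]
    [MeasurableSpace X] [BorelSpace X] [TopologicalSpace Y] [MeasurableSpace Y] [BorelSpace Y]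
    {f : X → Y} {F : Set X} (hF : F.Countable) (hf : ContinuousOn f Fᶜ) : Measurable f := by
  refine measurable_of_isOpen fun O hO => ?_
  obtain ⟨U, hU, hOU⟩ := continuousOn_iff'.1 hf O hO
  rw [← Set.inter_union_compl (f ⁻¹' O) Fᶜ, compl_compl, hOU]
  exact (hU.measurableSet.inter hF.measurableSet.compl).union
    (hF.mono Set.inter_subset_right).measurableSet

theorem measurable_riemannZeta : Measurable riemannZeta :=
  measurable_of_continuousOn_compl_singleton 1 fun _ hs =>
    (differentiableAt_riemannZeta hs).continuousAt.continuousWithinAt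

/-- The part of the line `Re s = c` with `T₀ ≤ |Im s| ≤ T`, which is the spectrum of
`c + i φ(V_c)` for every `(T₀, T)`-admissible `φ`. -/
def truncatedLine (c T₀ T : ℝ) : Set ℂ := {s | s.re = c ∧ T₀ ≤ |s.im| ∧ |s.im| ≤ T}

theorem isClosed_truncatedLine (c T₀ T : ℝ) : IsClosed (truncatedLine c T₀ T) :=
  (isClosed_eq Complex.continuous_re continuous_const).inter
    ((isClosed_le continuous_const Complex.continuous_im.abs).inter
      (isClosed_le Complex.continuous_im.abs continuous_const))

theorem isCompact_truncatedLine (c T₀ T : ℝ) : IsCompact (truncatedLine c T₀ T) := by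
  refine (isCompact_closedBall (0 : ℂ) (|c| + T)).of_isClosed_subset
    (isClosed_truncatedLine c T₀ T) fun s hs => ?_
  rw [mem_closedBall_zero_iff]
  calc ‖s‖ ≤ |s.re| + |s.im| := Complex.norm_le_abs_re_add_abs_im s
    _ ≤ |c| + T := by rw [hs.1]; gcongr; exact hs.2.2

theorem continuousOn_riemannZeta_truncatedLine (c : ℝ) {T₀ : ℝ} (hT₀ : 0 < T₀) (T : ℝ) :
    ContinuousOn riemannZeta (truncatedLine c T₀ T) := by
  intro s hs
  have im_ne_zero : s.im ≠ 0 := abs_pos.1 (hT₀.trans_le hs.2.1)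
  have ne_one : s ≠ 1 := fun h => im_ne_zero (by rw [h, Complex.one_im])
  exact (differentiableAt_riemannZeta ne_one).continuousAt.continuousWithinAt

section Spectrum

variable {c T₀ T : ℝ} {φ : ℝ → ℝ} {E : ResolutionOfIdentity (WeightedL2 c)} {s : ℂ}

theorem essRange_eq_range_ofReal (hE : E.IsIntegral (fun z => z) (momentumOperator c)) :
    E.essRange (fun z => z) = Set.range ((↑) : ℝ → ℂ) :=
  (hE.essRange_eq measurable_id' measurable_id' (isIntegral_momentumResolution c)).trans
    (essRange_momentumResolution c)

theorem eventually_re_notMem_of_finite (hE : E.IsIntegral (fun z => z) (momentumOperator c))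
    {F : Set ℝ} (hF : F.Finite) : ∀ᶠ z in E.ae, z.re ∉ F := by
  have real : ∀ᶠ z in E.ae, z ∈ Set.range ((↑) : ℝ → ℂ) := by
    rw [← essRange_eq_range_ofReal hE]
    exact E.eventually_mem_essRange _
  have no_atoms : ∀ᶠ z in E.ae, ∀ t ∈ F, z ≠ (t : ℂ) :=
    (eventually_all_finite hF).2 fun t _ =>
      (hE.eventually_ne_iff measurable_id' measurable_id' (isIntegral_momentumResolution c) t).2
        (eventually_ne_momentumResolution c t)
  filter_upwards [real, no_atoms] with z ⟨t, htz⟩ hz htF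
  subst htz
  exact hz t htF rfl

theorem IsAdmissibleCutoff.essRange_eq (hφ : IsAdmissibleCutoff c T₀ T φ)
    (hE : E.IsIntegral (fun z => z) (momentumOperator c)) :
    E.essRange (fun z => c + Complex.I * φ z.re) = truncatedLine c T₀ T := by
  obtain ⟨F, hF, -, hcont, hcl, -⟩ := hφ
  refine (ResolutionOfIdentity.essRange_subset (isClosed_truncatedLine c T₀ T) ?_).antisymm ?_
  · filter_upwards [eventually_re_notMem_of_finite hE hF] with z hz
    have hφz : φ z.re ∈ {τ : ℝ | T₀ ≤ |τ| ∧ |τ| ≤ T} :=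
      hcl ▸ subset_closure (Set.mem_image_of_mem φ hz)
    simpa [truncatedLine] using hφz
  · intro s hs
    let line (τ : ℝ) : ℂ := c + Complex.I * τ
    have line_mem : ∀ x ∈ Fᶜ, line (φ x) ∈ E.essRange (fun z => c + Complex.I * φ z.re) := by
      intro x hx
      have hφx : ContinuousAt φ (x : ℂ).re :=
        hcont.continuousAt (hF.isClosed.isOpen_compl.mem_nhds hx)
      refine ResolutionOfIdentity.apply_mem_essRange (a := (x : ℂ))
        (f := fun z => c + Complex.I * φ z.re) ?_ ?_
      · exact essRange_eq_range_ofReal hE ▸ Set.mem_range_self x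
      · have : ContinuousAt (fun z : ℂ => φ z.re) x :=
          hφx.comp Complex.continuous_re.continuousAt
        fun_prop
    have closure_subset : closure (φ '' Fᶜ) ⊆
        line ⁻¹' E.essRange (fun z => c + Complex.I * φ z.re) :=
      closure_minimal (Set.image_subset_iff.2 line_mem)
        (ResolutionOfIdentity.isClosed_essRange.preimage (by fun_prop))
    have hs_line : line s.im = s := Complex.ext (by simp [line, hs.1]) (by simp [line])
    exact hs_line ▸ closure_subset (hcl ▸ hs.2)

theorem IsAdmissibleCutoff.measurable (hφ : IsAdmissibleCutoff c T₀ T φ) : Measurable φ := by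
  obtain ⟨F, hF, -, hcont, -⟩ := hφ
  exact measurable_of_continuousOn_compl_countable hF.countable hcont

theorem exists_isIntegral_truncatedSpectralOperator (hφ : IsAdmissibleCutoff c T₀ T φ) :
    ∃ E : ResolutionOfIdentity (WeightedL2 c),
      E.IsIntegral riemannZeta (truncatedSpectralOperator c φ) ∧
      E.essRange (fun z => z) = truncatedLine c T₀ T := by
  have hφ_re : Measurable fun z : ℂ => (φ z.re : ℂ) :=
    Complex.measurable_ofReal.comp (hφ.measurable.comp Complex.measurable_re)
  have h_line : Measurable fun z : ℂ => c + Complex.I * (φ z.re : ℂ) :=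
    (hφ_re.const_mul _).const_add _
  obtain ⟨E₁, hV, hφV⟩ :=
    (isIntegral_momentumResolution c).isFunctionOf_functionalCalculus measurable_id' hφ_re
  have h_shift : E₁.IsIntegral (fun z => c + Complex.I * φ z.re) (truncatedShift c φ) :=
    hφV.affine hφ_re c Complex.I_ne_zero
  obtain ⟨E₂, h_shift', hζ⟩ :=
    h_shift.isFunctionOf_functionalCalculus h_line measurable_riemannZeta
  exact ⟨E₂, hζ, (h_shift'.essRange_eq measurable_id' h_line h_shift).trans (hφ.essRange_eq hV)⟩

theorem isInvertibleOperator_truncatedSpectralOperator (hφ : IsAdmissibleCutoff c T₀ T φ)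
    (hT₀ : 0 < T₀) (h : ∀ s ∈ truncatedLine c T₀ T, riemannZeta s ≠ 0) :
    IsInvertibleOperator (truncatedSpectralOperator c φ) := by
  obtain ⟨E, hζ, hE⟩ := exists_isIntegral_truncatedSpectralOperator hφ
  rw [hζ.isInvertibleOperator_iff measurable_riemannZeta]
  have isClosed_image : IsClosed (riemannZeta '' truncatedLine c T₀ T) :=
    ((isCompact_truncatedLine c T₀ T).image_of_continuousOn
      (continuousOn_riemannZeta_truncatedLine c hT₀ T)).isClosed
  have essRange_subset : E.essRange riemannZeta ⊆ riemannZeta '' truncatedLine c T₀ T :=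
    ResolutionOfIdentity.essRange_subset isClosed_image <|
      hE ▸ (E.eventually_mem_essRange fun z => z).mono fun _ => Set.mem_image_of_mem _
  intro h0
  obtain ⟨s, hs, hζs⟩ := essRange_subset h0
  exact h s hs hζs

theorem riemannZeta_ne_zero_of_isInvertibleOperator (hφ : IsAdmissibleCutoff c T₀ T φ)
    (h : IsInvertibleOperator (truncatedSpectralOperator c φ)) (hs : s ∈ truncatedLine c T₀ T) :
    riemannZeta s ≠ 0 := by
  intro hζs
  obtain ⟨E, hζ, hE⟩ := exists_isIntegral_truncatedSpectralOperator hφ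
  have ne_one : s ≠ 1 := by
    rintro rfl
    exact riemannZeta_one_ne_zero hζs
  refine (hζ.isInvertibleOperator_iff measurable_riemannZeta).1 h (hζs ▸ ?_)
  exact ResolutionOfIdentity.apply_mem_essRange (hE ▸ hs)
    (differentiableAt_riemannZeta ne_one).continuousAt

end Spectrum

/-! ### Cut-off functions -/

section Cutoff

theorem image_sin_eq_Icc {a : ℝ} {S : Set ℝ} (hS : Set.Icc a (a + 2 * Real.pi) ⊆ S) :
    Real.sin '' S = Set.Icc (-1) 1 := by
  refine Real.range_sin ▸ (Set.image_subset_range _ _).antisymm ?_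
  rw [← Real.sin_periodic.image_Icc Real.two_pi_pos a]
  exact Set.image_mono hS

theorem image_add_mul_sin_eq_Icc {a : ℝ} {S : Set ℝ} (hS : Set.Icc a (a + 2 * Real.pi) ⊆ S)
    (m : ℝ) {r : ℝ} (hr : 0 < r) :
    (fun x => m + r * Real.sin x) '' S = Set.Icc (m - r) (m + r) := by
  calc (fun x => m + r * Real.sin x) '' S
      = (fun x => m + x) '' ((fun x => r * x) '' (Real.sin '' S)) := by
        simp only [Set.image_image]
    _ = Set.Icc (m - r) (m + r) := by
        rw [image_sin_eq_Icc hS, Set.image_mul_left_Icc' hr, Set.image_const_add_Icc, mul_neg_one,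
          mul_one, ← sub_eq_add_neg]

theorem setOf_abs_mem_Icc {T₀ : ℝ} (h0 : 0 ≤ T₀) (T : ℝ) :
    {τ : ℝ | T₀ ≤ |τ| ∧ |τ| ≤ T} = Set.Icc T₀ T ∪ Set.Icc (-T) (-T₀) := by
  ext τ
  simp only [Set.mem_ofPred_eq, Set.mem_union, Set.mem_Icc]
  rcases abs_cases τ with ⟨h, -⟩ | ⟨h, -⟩ <;> grind

theorem isAdmissibleCutoff_mul_sin (c : ℝ) {T : ℝ} (hT : 0 < T) :
    IsAdmissibleCutoff c 0 T fun x => T * Real.sin x := by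
  refine ⟨∅, Set.finite_empty, fun _ => rfl, by fun_prop, ?_,
    fun _ => ⟨Set.univ, fun z => T * Complex.sin z, isOpen_univ, by fun_prop, by simp⟩⟩
  have image_eq := image_add_mul_sin_eq_Icc (Set.subset_univ (Set.Icc 0 _)) 0 hT
  simp only [zero_add, zero_sub] at image_eq
  rw [Set.compl_empty, image_eq, isClosed_Icc.closure_eq]
  simp only [abs_nonneg, true_and, abs_le, Set.Icc_def]

/-- A cut-off function with a jump at the origin: it oscillates between `T₀` and `T` on the
positive half-line, and between `-T` and `-T₀` on the rest of the line. -/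
noncomputable def jumpCutoff (T₀ T x : ℝ) : ℝ :=
  (if 0 < x then (T₀ + T) / 2 else -((T₀ + T) / 2)) + (T - T₀) / 2 * Real.sin x

theorem image_jumpCutoff_Ioi {T₀ T : ℝ} (hT : T₀ < T) :
    jumpCutoff T₀ T '' Set.Ioi 0 = Set.Icc T₀ T := by
  have subset_Ioi : Set.Icc 1 (1 + 2 * Real.pi) ⊆ Set.Ioi 0 := fun x hx => one_pos.trans_le hx.1
  have eqOn : Set.EqOn (jumpCutoff T₀ T) (fun x => (T₀ + T) / 2 + (T - T₀) / 2 * Real.sin x)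
      (Set.Ioi 0) := fun x (hx : 0 < x) => by rw [jumpCutoff, if_pos hx]
  rw [eqOn.image_eq, image_add_mul_sin_eq_Icc subset_Ioi _ (half_pos (sub_pos.2 hT))]
  congr 1 <;> ring

theorem image_jumpCutoff_Iio {T₀ T : ℝ} (hT : T₀ < T) :
    jumpCutoff T₀ T '' Set.Iio 0 = Set.Icc (-T) (-T₀) := by
  have subset_Iio : Set.Icc (-1 - 2 * Real.pi) (-1 - 2 * Real.pi + 2 * Real.pi) ⊆ Set.Iio 0 :=
    fun x hx => hx.2.trans_lt (by linarith)
  have eqOn : Set.EqOn (jumpCutoff T₀ T) (fun x => -((T₀ + T) / 2) + (T - T₀) / 2 * Real.sin x)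
      (Set.Iio 0) := fun x hx => by rw [jumpCutoff, if_neg (lt_asymm hx)]
  rw [eqOn.image_eq, image_add_mul_sin_eq_Icc subset_Iio _ (half_pos (sub_pos.2 hT))]
  congr 1 <;> ring

theorem differentiableOn_ite_re_pos (a b : ℂ) :
    DifferentiableOn ℂ (fun z : ℂ => if 0 < z.re then a else b) {z | z.re ≠ 0} := by
  intro z hz
  refine DifferentiableAt.differentiableWithinAt ?_
  rcases hz.lt_or_gt with h | h
  · refine (differentiableAt_const b).congr_of_eventuallyEq ?_
    filter_upwards [Complex.continuous_re.continuousAt.eventually_lt_const h] with w hw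
    exact if_neg hw.not_gt
  · refine (differentiableAt_const a).congr_of_eventuallyEq ?_
    filter_upwards [Complex.continuous_re.continuousAt.eventually_const_lt h] with w hw
    exact if_pos hw

theorem exists_differentiableOn_eq_jumpCutoff (T₀ T : ℝ) :
    ∃ g : ℂ → ℂ, DifferentiableOn ℂ g {z | z.re ≠ 0} ∧ ∀ x : ℝ, g x = jumpCutoff T₀ T x := by
  refine ⟨fun z => (if 0 < z.re then ((T₀ + T) / 2 : ℂ) else -((T₀ + T) / 2)) +
    (T - T₀) / 2 * Complex.sin z, ?_, fun x => ?_⟩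
  · exact (differentiableOn_ite_re_pos _ _).add (by fun_prop)
  · simp only [Complex.ofReal_re, jumpCutoff]
    split_ifs <;> push_cast <;> rfl

theorem isAdmissibleCutoff_jumpCutoff (c : ℝ) {T₀ T : ℝ} (h0 : 0 < T₀) (hT : T₀ < T) :
    IsAdmissibleCutoff c T₀ T (jumpCutoff T₀ T) := by
  obtain ⟨g, hg, hg_eq⟩ := exists_differentiableOn_eq_jumpCutoff T₀ T
  refine ⟨{0}, Set.finite_singleton 0, fun h => absurd h h0.ne', ?_, ?_, fun _ =>
    ⟨{z | z.re ≠ 0}, g, isOpen_ne.preimage Complex.continuous_re, hg, fun x hx => ⟨hx, hg_eq x⟩⟩⟩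
  · have eq_re : jumpCutoff T₀ T = fun x : ℝ => (g x).re := by
      ext x
      rw [hg_eq, Complex.ofReal_re]
    rw [eq_re]
    exact Complex.continuous_re.comp_continuousOn
      (hg.continuousOn.comp Complex.continuous_ofReal.continuousOn fun _ hx => hx)
  · rw [← Set.Iio_union_Ioi, Set.image_union, image_jumpCutoff_Iio hT, image_jumpCutoff_Ioi hT,
      (isClosed_Icc.union isClosed_Icc).closure_eq, setOf_abs_mem_Icc h0.le, Set.union_comm]

theorem exists_isAdmissibleCutoff (c : ℝ) {T₀ T : ℝ} (h0 : 0 ≤ T₀) (hT : T₀ < T) :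
    ∃ φ, IsAdmissibleCutoff c T₀ T φ := by
  rcases h0.eq_or_lt with rfl | h
  · exact ⟨_, isAdmissibleCutoff_mul_sin c hT⟩
  · exact ⟨_, isAdmissibleCutoff_jumpCutoff c h hT⟩

end Cutoff

section AlmostInvertible

variable {c : ℝ}

theorem AlmostInvertible.forSome (h : AlmostInvertible c) : AlmostInvertibleForSome c := by
  obtain ⟨T₀, h0, h⟩ := h
  refine ⟨T₀, h0, fun T hT => ?_⟩
  obtain ⟨φ, hφ⟩ := exists_isAdmissibleCutoff c h0 hT
  exact ⟨φ, hφ, h T hT φ hφ⟩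

theorem AlmostInvertibleForSome.finite_zeros (h : AlmostInvertibleForSome c) :
    {s : ℂ | s.re = c ∧ riemannZeta s = 0}.Finite := by
  obtain ⟨T₀, -, h⟩ := h
  refine (isCompact_truncatedLine c 0 T₀).inter_riemannZetaZeros_finite.subset fun s hs => ?_
  refine ⟨⟨hs.1, abs_nonneg _, ?_⟩, hs.2⟩
  by_contra! hlt
  obtain ⟨φ, hφ, hinv⟩ := h |s.im| hlt
  exact riemannZeta_ne_zero_of_isInvertibleOperator hφ hinv ⟨hs.1, hlt.le, le_rfl⟩ hs.2

theorem almostInvertible_of_finite_zeros (h : {s : ℂ | s.re = c ∧ riemannZeta s = 0}.Finite) :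
    AlmostInvertible c := by
  obtain ⟨M, hM⟩ := (h.image fun s => |s.im|).bddAbove
  have hT₀ : 0 < max M 0 + 1 := by positivity
  refine ⟨max M 0 + 1, hT₀.le, fun T _ φ hφ => ?_⟩
  refine isInvertibleOperator_truncatedSpectralOperator hφ hT₀ fun s hs hζs => ?_
  have h_le : |s.im| ≤ M := hM ⟨s, ⟨hs.1, hζs⟩, rfl⟩
  linarith [le_max_left M 0, hs.2.1]

end AlmostInvertible

theorem theorem5p6_general (c : ℝ) :
    (AlmostInvertible c ↔ {s : ℂ | s.re = c ∧ riemannZeta s = 0}.Finite) ∧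
      (AlmostInvertibleForSome c ↔ {s : ℂ | s.re = c ∧ riemannZeta s = 0}.Finite) :=
  ⟨⟨fun h => h.forSome.finite_zeros, almostInvertible_of_finite_zeros⟩,
    ⟨fun h => h.finite_zeros, fun h => (almostInvertible_of_finite_zeros h).forSome⟩⟩

theorem theorem5p6 (c : ℝ) (hc : 0 ≤ c) :
    (AlmostInvertible c ↔ {s : ℂ | s.re = c ∧ riemannZeta s = 0}.Finite) ∧
      (AlmostInvertibleForSome c ↔ {s : ℂ | s.re = c ∧ riemannZeta s = 0}.Finite) :=
  theorem5p6_general c
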